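/- Setting. Let $S=[a,b]$ with $a<b$, let $n\ge 1$, $s>0$, let $r,\nu\ge 1$ be integers, and for $1\le p\le n$ let $\theta_p:S\to S$ be Lipschitz and $g_p:S\to[0,\infty)$ continuous and not identically zero, with $\theta_p,g_p\in C^{r+1}(S)$. Assume that there is $M_0>0$ with $g_p(t_1)\le g_p(t_2)e^{M_0|t_1-t_2|}$ for all $p$ and all $t_1,t_2\in S$. For a word $\omega=(p_1,\dots,p_k)$ put $\theta_\omega=\theta_{p_1}\circ\cdots\circ\theta_{p_k}$ and $g_\omega(t)=g_{p_1}(\theta_{p_2}\circ\cdots\circ\theta_{p_k}(t))\cdots g_{p_{k-1}}(\theta_{p_k}(t))\,g_{p_k}(t)$, and assume that there are $C_0\ge1$ and $0<\kappa<1$ with $|\theta_\omega(t_1)-\theta_\omega(t_2)|\le C_0\kappa^k|t_1-t_2|$ for all $k\ge1$, all words $\omega$ of length $k$ and all $t_1,t_2\in S$. Let $\Omega_\nu$ be the set of words of length $\nu$. Let $(L_sf)(t)=\sum_{p=1}^n g_p(t)^sf(\theta_p(t))$ on $C(S)$ and let $\lambda_s=R(L_s)$ be its spectral radius (the spectrum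 being that of the complexification). Let $v_s\in C^{r+1}(S)$ be a strictly positive eigenfunction of $L_s$, and let $E$ and $\chi>0$ be constants such that for all $x,x_1,x_2\in S$ $$\frac{|v_s^{(r+1)}(x)|}{v_s(x)}\le E,\qquad v_s(x_1)\le v_s(x_2)\exp(2s|x_1-x_2|/\chi).$$ Mesh. Let $[a_i,b_i]\subset S$, $a_i<b_i$, $1\le i\le I$, with $b_i<a_{i+1}$ for $1\le i<I$, be such that for each $\omega\in\Omega_\nu$ there is an $i$ with $\theta_\omega(S)\subset[a_i,b_i]$. Let $N_i\ge1$ be integers, $h_i=(b_i-a_i)/N_i$, $h=\max_ih_i$, $h_{\min}=\min_i h_i$, $\mu=h/h_{\min}$, $t^i_j=a_i+jh_i$, and let $$c^i_{j,k}=t^i_{j-1}+\frac{h_i}{2}\Big(1-\frac{\cos(\frac{2k+1}{2r+2}\pi)}{\cos(\frac{\pi}{2r+2})}\Big),\qquad 1\le j\le N_i,\ 0\le k\le r,$$ and $T=\{c^i_{j,k}\}$. For $F:T\to\mathbb R$ let $\mathcal F:\bigcup_i[a_i,b_i]\to\mathbb R$ be the continuous function which on each $[t^i_{j-1},t^i_j]$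 is the polynomial of degree $\le r$ with the values $F(c^i_{j,k})$ at $c^i_{j,k}$, $0\le k\le r$, and let $$(\mathbf L_{s,\nu}F)(\xi)=\sum_{\omega\in\Omega_\nu}g_\omega(\xi)^s\,\mathcal F(\theta_\omega(\xi)),\qquad \xi\in T,$$ a linear map of $\mathbb R^T$, identified with its matrix, with spectral radius $R(\mathbf L_{s,\nu})$. For $M>0$ let $K(M;T)=\{F:T\to\mathbb R:\ F(\xi)\le e^{M|\xi-\eta|}F(\eta)\ \text{for all}\ \xi,\eta\in T\}$. Constants. Write $\sigma=\sin\frac{\pi}{2r+2}$ and $$G=E\,e^{2sh/\chi}\,\frac{1}{(r+1)!}\Big[\frac{1}{2\cos(\pi/(2r+2))}\Big]^{r+1}\frac1{2^r},\qquad M_1=\frac{\mu}{\sigma^2}\,\frac{Gh^r}{1-G^2h^{2r+2}}+\frac{2s}{\chi}.$$ Assume that $2\sigma^2h_i\le a_{i+1}-b_i$ for $1\le i<I$, that $h<1$ and $Gh^{r+1}<1$. Let $H>G$ and $$M_2=M_1+\frac GH\,\frac{\mu}{1-[(G/H)h]^2}\,\frac1{\sigma^2},$$ and assume that $\mathbf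 L_{s,\nu}(K(M;T))\subset K(M';T)$ for some $0<M'<M$ with $M\ge M_2$. Theorem. Under these assumptions $$\big[(1+Hh^r)^{-1}R(\mathbf L_{s,\nu})\big]^{1/\nu}\le\lambda_s,\qquad\text{and, if } Hh^r<1,\qquad \lambda_s\le\big[(1-Hh^r)^{-1}R(\mathbf L_{s,\nu})\big]^{1/\nu}.$$ Moreover the entries of the matrices $(1+Hh^r)^{-1}\mathbf L_{s,\nu}$ and $(1-Hh^r)^{-1}\mathbf L_{s,\nu}$ differ by $O(h^r)$: for every $H_{\max}>0$ there are $C,h_0>0$, depending only on $S$, the $\theta_p,g_p$, $s$, $r$, $\nu$ and $H_{\max}$, such that for every mesh as above with $h\le h_0$ (only the condition $\theta_\omega(S)\subset[a_i,b_i]$ and the ordering of the intervals are needed) and every $0<H\le H_{\max}$ one has $Hh^r<1$, and all the entries of the difference of the two matrices are at most $Ch^r$ in absolute value. -/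

import Mathlib

noncomputable section

namespace TransferIFS

open Set

/-! ### The iterated function system and its transfer operator -/

/-- A system of `n` Lipschitz maps `θ p : S → S` and `n` nonnegative continuous weights
`g p : S → [0, ∞)` on the interval `S = [a, b]`.  (The values outside `S` play no role.) -/
structure IFS (a b : ℝ) (n : ℕ) where
  θ : Fin n → ℝ → ℝ
  g : Fin n → ℝ → ℝ
  mapsTo : ∀ p, MapsTo (θ p) (Icc a b) (Icc a b)
  lipschitz : ∀ p, ∃ K, LipschitzOnWith K (θ p) (Icc a b)
  g_cont : ∀ p, ContinuousOn (g p) (Icc a b)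
  g_nonneg : ∀ p, ∀ t ∈ Icc a b, 0 ≤ g p t

namespace IFS

variable {a b : ℝ} {n : ℕ}

/-- `θ p` as a continuous self-map of `S = [a, b]`. -/
def θC (F : IFS a b n) (p : Fin n) : C(Icc a b, Icc a b) where
  toFun t := ⟨F.θ p t, F.mapsTo p t.2⟩
  continuous_toFun := by
    obtain ⟨K, hK⟩ := F.lipschitz p
    exact (continuousOn_iff_continuous_domRestrict.1 hK.continuousOn).subtype_mk _

/-- `t ↦ (g p t) ^ s` as a continuous function on `S = [a, b]` with values in `𝕜`. -/
def gC (𝕜 : Type) [RCLike 𝕜] (F : IFS a b n) (s : ℝ) (hs : 0 < s) (p : Fin n) :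
    C(Icc a b, 𝕜) where
  toFun t := ((F.g p t ^ s : ℝ) : 𝕜)
  continuous_toFun :=
    RCLike.continuous_ofReal.comp
      ((continuousOn_iff_continuous_domRestrict.1 (F.g_cont p)).rpow_const fun _ => Or.inr hs.le)

/-- Composition with a continuous self-map, as a bounded operator on `C(S)`. -/
def compOp (𝕜 : Type) [RCLike 𝕜] (φ : C(Icc a b, Icc a b)) :
    C(Icc a b, 𝕜) →L[𝕜] C(Icc a b, 𝕜) where
  toFun f := f.comp φ
  map_add' _ _ := rfl
  map_smul' _ _ := rfl
  cont := ContinuousMap.continuous_precomp φ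

/-- The Perron-Frobenius (transfer) operator
`(L_s f)(t) = ∑ p, (g p t) ^ s * f (θ p t)` on `C(S, 𝕜)`. -/
def transferOp (𝕜 : Type) [RCLike 𝕜] (F : IFS a b n) (s : ℝ) (hs : 0 < s) :
    C(Icc a b, 𝕜) →L[𝕜] C(Icc a b, 𝕜) :=
  ∑ p, (ContinuousLinearMap.mul 𝕜 C(Icc a b, 𝕜) (F.gC 𝕜 s hs p)).comp (compOp 𝕜 (F.θC p))

theorem transferOp_apply (𝕜 : Type) [RCLike 𝕜] (F : IFS a b n) (s : ℝ) (hs : 0 < s)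
    (f : C(Icc a b, 𝕜)) (t : Icc a b) :
    F.transferOp 𝕜 s hs f t
      = ∑ p, ((F.g p t ^ s : ℝ) : 𝕜) * f ⟨F.θ p t, F.mapsTo p t.2⟩ := by
  simp only [transferOp, sum_apply, ContinuousMap.coe_sum,
    Finset.sum_apply]
  rfl

/-- `λ_s`, the spectral radius of `L_s`.  As usual for a real Banach space, the spectrum is that
of the complexification, which is the same operator acting on `C(S, ℂ)`. -/
def lam (F : IFS a b n) (s : ℝ) (hs : 0 < s) : ℝ :=
  (spectralRadius ℂ (F.transferOp ℂ s hs)).toReal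

/-- `θ_ω = θ_{p₁} ∘ ⋯ ∘ θ_{p_ν}` for `ω = (p₁, …, p_ν)`. -/
def wordMap (F : IFS a b n) : List (Fin n) → ℝ → ℝ
  | [], t => t
  | p :: w, t => F.θ p (F.wordMap w t)

/-- `g_ω(t) = g_{p₁}(θ_{p₂} ∘ ⋯ ∘ θ_{p_ν}(t)) ⋯ g_{p_{ν-1}}(θ_{p_ν}(t)) g_{p_ν}(t)`. -/
def wordWeight (F : IFS a b n) : List (Fin n) → ℝ → ℝ
  | [], _ => 1
  | p :: w, t => F.g p (F.wordMap w t) * F.wordWeight w t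

/-- The weights are not identically zero and satisfy
`g p t₁ ≤ g p t₂ * exp (M₀ * |t₁ - t₂|)` with one constant `M₀ > 0`. -/
def LogLipschitzWeights (F : IFS a b n) : Prop :=
  (∀ p, ∃ t ∈ Icc a b, F.g p t ≠ 0) ∧
    ∃ M₀ > 0, ∀ p, ∀ t₁ ∈ Icc a b, ∀ t₂ ∈ Icc a b,
      F.g p t₁ ≤ F.g p t₂ * Real.exp (M₀ * |t₁ - t₂|)

/-- There are `C₀ ≥ 1` and `0 < κ < 1` such that `θ_ω` has Lipschitz constant `C₀ κ ^ ν` on `S`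
for all `ν ≥ 1` and all words `ω` of length `ν`. -/
def UniformlyContracting (F : IFS a b n) : Prop :=
  ∃ C₀ κ : ℝ, 1 ≤ C₀ ∧ 0 < κ ∧ κ < 1 ∧
    ∀ w : List (Fin n), w ≠ [] → ∀ t₁ ∈ Icc a b, ∀ t₂ ∈ Icc a b,
      |F.wordMap w t₁ - F.wordMap w t₂| ≤ C₀ * κ ^ w.length * |t₁ - t₂|

/-- All `θ p` and `g p` are of class `C^m` on `S`. -/
def Smooth (F : IFS a b n) (m : ℕ) : Prop :=
  ∀ p, ContDiffOn ℝ m (F.θ p) (Icc a b) ∧ ContDiffOn ℝ m (F.g p) (Icc a b)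

/-- `v` is a strictly positive eigenfunction of `L_s` of class `C^m` on `S`. -/
structure IsPositiveEigenfunction (F : IFS a b n) (s : ℝ) (hs : 0 < s) (m : ℕ) (v : ℝ → ℝ) :
    Prop where
  contDiffOn : ContDiffOn ℝ m v (Icc a b)
  pos : ∀ t ∈ Icc a b, 0 < v t
  eigen : ∃ f : C(Icc a b, ℝ), (∀ t, f t = v t) ∧ ∃ c : ℝ, F.transferOp ℝ s hs f = c • f

end IFS

/-! ### The mesh -/

/-- Linearly ordered, pairwise disjoint nondegenerate compact subintervals
`[lo i, hi i] ⊆ [a, b]`, the `i`-th one to be cut into `N i ≥ 1` equal pieces. -/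
structure Mesh (a b : ℝ) where
  I : ℕ
  lo : Fin I → ℝ
  hi : Fin I → ℝ
  N : Fin I → ℕ
  lo_lt_hi : ∀ i, lo i < hi i
  le_lo : ∀ i, a ≤ lo i
  hi_le : ∀ i, hi i ≤ b
  hi_lt_lo : ∀ i j, i < j → hi i < lo j
  N_pos : ∀ i, 0 < N i

namespace Mesh

variable {a b : ℝ}

/-- `h_i`, the width of the pieces of the `i`-th interval. -/
def width (m : Mesh a b) (i : Fin m.I) : ℝ := (m.hi i - m.lo i) / m.N i

/-- `h = max_i h_i`. -/
def h (m : Mesh a b) : ℝ := ⨆ i, m.width i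

/-- `h_min = min_i h_i`. -/
def hmin (m : Mesh a b) : ℝ := ⨅ i, m.width i

/-- `μ = h / h_min`. -/
def μ (m : Mesh a b) : ℝ := m.h / m.hmin

/-- Left endpoint of the `j`-th piece of the `i`-th interval (`j = 0, …, N i - 1`). -/
def left (m : Mesh a b) (i : Fin m.I) (j : Fin (m.N i)) : ℝ := m.lo i + j * m.width i

/-- Right endpoint of the `j`-th piece of the `i`-th interval. -/
def right (m : Mesh a b) (i : Fin m.I) (j : Fin (m.N i)) : ℝ := m.lo i + (j + 1) * m.width i

/-- The `k`-th extended Chebyshev point, `0 ≤ k ≤ r`, of the `j`-th piece of the `i`-th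
interval. -/
def node (m : Mesh a b) (r : ℕ) (i : Fin m.I) (j : Fin (m.N i)) (k : Fin (r + 1)) : ℝ :=
  m.left i j + m.width i / 2 *
    (1 - Real.cos ((2 * k + 1) / (2 * r + 2) * Real.pi) / Real.cos (Real.pi / (2 * r + 2)))

/-- The finite set `T` of all nodes. -/
def nodes (m : Mesh a b) (r : ℕ) : Finset ℝ :=
  Finset.univ.image fun x : (Σ i : Fin m.I, Fin (m.N i) × Fin (r + 1)) =>
    m.node r x.1 x.2.1 x.2.2

theorem node_mem (m : Mesh a b) (r : ℕ) (i : Fin m.I) (j : Fin (m.N i)) (k : Fin (r + 1)) :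
    m.node r i j k ∈ m.nodes r :=
  Finset.mem_image.2 ⟨⟨i, j, k⟩, Finset.mem_univ _, rfl⟩

/-- The polynomial of degree at most `r` that takes the values of `F` at the nodes of the `j`-th
piece of the `i`-th interval, as a linear function of `F`. -/
def cellPoly (m : Mesh a b) (r : ℕ) (i : Fin m.I) (j : Fin (m.N i)) :
    (m.nodes r → ℝ) →ₗ[ℝ] Polynomial ℝ :=
  (Lagrange.interpolate Finset.univ (m.node r i j)).comp
    (LinearMap.funLeft ℝ ℝ fun k => (⟨m.node r i j k, m.node_mem r i j k⟩ : m.nodes r))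

/-- `x` lies in some piece of some interval, that is, `x ∈ ⋃ i, [lo i, hi i]`. -/
def InCell (m : Mesh a b) (x : ℝ) : Prop :=
  ∃ c : (Σ i : Fin m.I, Fin (m.N i)), x ∈ Icc (m.left c.1 c.2) (m.right c.1 c.2)

open Classical in
/-- The continuous piecewise polynomial `𝓕` on `⋃ i, [lo i, hi i]` with the values `F` at the
nodes, evaluated at `x`, as a linear function of `F`.  At a point that two pieces share both
polynomials have the same value, see `interp_eq`; outside the intervals the value is `0`. -/
def interp (m : Mesh a b) (r : ℕ) (x : ℝ) : (m.nodes r → ℝ) →ₗ[ℝ] ℝ :=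
  if hx : m.InCell x then
    (Polynomial.leval x).comp (m.cellPoly r hx.choose.1 hx.choose.2)
  else 0

theorem width_pos (m : Mesh a b) (i : Fin m.I) : 0 < m.width i :=
  div_pos (sub_pos.2 (m.lo_lt_hi i)) (Nat.cast_pos.2 (m.N_pos i))

theorem right_le_hi (m : Mesh a b) (i : Fin m.I) (j : Fin (m.N i)) : m.right i j ≤ m.hi i := by
  have hN : (0 : ℝ) < m.N i := Nat.cast_pos.2 (m.N_pos i)
  have h1 : (m.N i : ℝ) * m.width i = m.hi i - m.lo i := by
    unfold width; field_simp
  have h2 : ((j : ℕ) : ℝ) + 1 ≤ m.N i := by exact_mod_cast j.2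
  have := mul_le_mul_of_nonneg_right h2 (m.width_pos i).le
  unfold right
  linarith

theorem lo_le_left (m : Mesh a b) (i : Fin m.I) (j : Fin (m.N i)) : m.lo i ≤ m.left i j := by
  have : 0 ≤ ((j : ℕ) : ℝ) * m.width i := mul_nonneg (Nat.cast_nonneg _) (m.width_pos i).le
  unfold left
  linarith

theorem cos_pos {r : ℕ} (hr : 1 ≤ r) : 0 < Real.cos (Real.pi / (2 * r + 2)) := by
  have hr' : (1 : ℝ) ≤ r := by exact_mod_cast hr
  have hp := Real.pi_pos
  apply Real.cos_pos_of_mem_Ioo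
  constructor
  · have : 0 < Real.pi / (2 * r + 2) := by positivity
    linarith
  · rw [div_lt_div_iff_of_pos_left hp (by positivity) (by norm_num)]
    linarith

theorem node_zero (m : Mesh a b) {r : ℕ} (hr : 1 ≤ r) (i : Fin m.I) (j : Fin (m.N i)) :
    m.node r i j 0 = m.left i j := by
  have hc := (cos_pos hr).ne'
  have : (2 * ((0 : Fin (r + 1)) : ℕ) + 1 : ℝ) / (2 * r + 2) * Real.pi
      = Real.pi / (2 * r + 2) := by
    simp; ring
  unfold node
  rw [this, div_self hc]
  ring

theorem node_last (m : Mesh a b) {r : ℕ} (hr : 1 ≤ r) (i : Fin m.I) (j : Fin (m.N i)) :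
    m.node r i j (Fin.last r) = m.right i j := by
  have hc := (cos_pos hr).ne'
  have : (2 * ((Fin.last r : Fin (r + 1)) : ℕ) + 1 : ℝ) / (2 * r + 2) * Real.pi
      = Real.pi - Real.pi / (2 * r + 2) := by
    have : (2 * r + 2 : ℝ) ≠ 0 := by positivity
    simp only [Fin.val_last]
    field_simp
    ring
  unfold node
  rw [this, Real.cos_pi_sub, neg_div, div_self hc]
  unfold left right
  ring

theorem node_injective (m : Mesh a b) {r : ℕ} (hr : 1 ≤ r) (i : Fin m.I) (j : Fin (m.N i)) :
    Function.Injective (m.node r i j) := by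
  intro k l hkl
  have hc := cos_pos hr
  have hw := m.width_pos i
  have hd : (0 : ℝ) < 2 * r + 2 := by positivity
  have hmem : ∀ q : Fin (r + 1),
      (2 * ((q : ℕ) : ℝ) + 1) / (2 * r + 2) * Real.pi ∈ Icc 0 Real.pi := by
    intro q
    have hq : ((q : ℕ) : ℝ) ≤ r := by exact_mod_cast Nat.lt_succ_iff.1 q.2
    refine ⟨by positivity, ?_⟩
    have : (2 * ((q : ℕ) : ℝ) + 1) / (2 * r + 2) ≤ 1 := by
      rw [div_le_one hd]; linarith
    nlinarith [Real.pi_pos]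
  have h1 : Real.cos ((2 * ((k : ℕ) : ℝ) + 1) / (2 * r + 2) * Real.pi)
      = Real.cos ((2 * ((l : ℕ) : ℝ) + 1) / (2 * r + 2) * Real.pi) := by
    unfold node at hkl
    have h2 := mul_left_cancel₀ (by positivity : m.width i / 2 ≠ 0) (add_left_cancel hkl)
    have h3 := sub_right_injective h2
    exact (div_left_inj' hc.ne').1 h3
  have h4 := Real.injOn_cos (hmem k) (hmem l) h1
  have h5 := mul_right_cancel₀ Real.pi_pos.ne' h4
  have h6 := (div_left_inj' hd.ne').1 h5
  have h7 : ((k : ℕ) : ℝ) = ((l : ℕ) : ℝ) := by linarith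
  exact Fin.ext (by exact_mod_cast h7)

theorem eval_cellPoly_node (m : Mesh a b) {r : ℕ} (hr : 1 ≤ r) (i : Fin m.I) (j : Fin (m.N i))
    (F : m.nodes r → ℝ) (k : Fin (r + 1)) :
    (m.cellPoly r i j F).eval (m.node r i j k) = F ⟨m.node r i j k, m.node_mem r i j k⟩ :=
  Lagrange.eval_interpolate_at_node (r := fun k => F ⟨m.node r i j k, m.node_mem r i j k⟩)
    (m.node_injective hr i j).injOn (Finset.mem_univ k)

theorem eval_cellPoly_left (m : Mesh a b) {r : ℕ} (hr : 1 ≤ r) (i : Fin m.I) (j : Fin (m.N i))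
    (F : m.nodes r → ℝ) (hx : m.left i j ∈ m.nodes r) :
    (m.cellPoly r i j F).eval (m.left i j) = F ⟨m.left i j, hx⟩ := by
  have := m.eval_cellPoly_node hr i j F 0
  simp only [m.node_zero hr] at this
  exact this

theorem eval_cellPoly_right (m : Mesh a b) {r : ℕ} (hr : 1 ≤ r) (i : Fin m.I) (j : Fin (m.N i))
    (F : m.nodes r → ℝ) (hx : m.right i j ∈ m.nodes r) :
    (m.cellPoly r i j F).eval (m.right i j) = F ⟨m.right i j, hx⟩ := by
  have := m.eval_cellPoly_node hr i j F (Fin.last r)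
  simp only [m.node_last hr] at this
  exact this

theorem cellPoly_agree_of_lt (m : Mesh a b) {r : ℕ} (hr : 1 ≤ r) (i : Fin m.I)
    (j j' : Fin (m.N i)) (hj : j < j') (F : m.nodes r → ℝ) {x : ℝ} (hx : x ≤ m.right i j)
    (hx' : m.left i j' ≤ x) :
    (m.cellPoly r i j F).eval x = (m.cellPoly r i j' F).eval x := by
  have hw := m.width_pos i
  have h1 : ((j : ℕ) : ℝ) + 1 ≤ ((j' : ℕ) : ℝ) := by exact_mod_cast hj
  have h2 : m.right i j ≤ m.left i j' := by
    have := mul_le_mul_of_nonneg_right h1 hw.le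
    unfold right left
    linarith
  have e1 : x = m.right i j := le_antisymm hx (h2.trans hx')
  have e2 : x = m.left i j' := le_antisymm (hx.trans h2) hx'
  have hmem : x ∈ m.nodes r := by
    rw [e2, ← m.node_zero hr]; exact m.node_mem r i j' 0
  calc (m.cellPoly r i j F).eval x = F ⟨x, hmem⟩ := by
        subst e1; exact m.eval_cellPoly_right hr i j F hmem
    _ = _ := by
        clear e1
        subst e2; exact (m.eval_cellPoly_left hr i j' F hmem).symm

/-- On every piece, `interp` is the Lagrange interpolation polynomial of that piece. -/
theorem interp_eq (m : Mesh a b) {r : ℕ} (hr : 1 ≤ r) (i : Fin m.I) (j : Fin (m.N i))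
    {x : ℝ} (hx : x ∈ Icc (m.left i j) (m.right i j)) (F : m.nodes r → ℝ) :
    m.interp r x F = (m.cellPoly r i j F).eval x := by
  have hc : m.InCell x := ⟨⟨i, j⟩, hx⟩
  have key : ∀ c : (Σ i : Fin m.I, Fin (m.N i)), x ∈ Icc (m.left c.1 c.2) (m.right c.1 c.2) →
      (m.cellPoly r c.1 c.2 F).eval x = (m.cellPoly r i j F).eval x := by
    rintro ⟨i', j'⟩ hx'
    simp only at hx' ⊢
    rcases lt_trichotomy i i' with hlt | heq | hlt
    · have := m.hi_lt_lo i i' hlt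
      have := m.right_le_hi i j
      have := m.lo_le_left i' j'
      linarith [hx.2, hx'.1]
    · subst heq
      rcases lt_trichotomy j j' with hj | hj | hj
      · exact (m.cellPoly_agree_of_lt hr i j j' hj F hx.2 hx'.1).symm
      · rw [hj]
      · exact m.cellPoly_agree_of_lt hr i j' j hj F hx'.2 hx.1
    · have := m.hi_lt_lo i' i hlt
      have := m.right_le_hi i' j'
      have := m.lo_le_left i j
      linarith [hx.1, hx'.2]
  unfold interp
  rw [dif_pos hc]
  exact key hc.choose hc.choose_spec

/-- Every `θ_ω` with `ω` of length `ν` maps `S` into one of the intervals of the mesh. -/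
def Absorbs {n : ℕ} (m : Mesh a b) (F : IFS a b n) (ν : ℕ) : Prop :=
  ∀ ω : Fin ν → Fin n, ∃ i, MapsTo (F.wordMap (List.ofFn ω)) (Icc a b) (Icc (m.lo i) (m.hi i))

/-- The discrete operator
`(𝐋_{s,ν} f)(ξ) = ∑ ω, g_ω(ξ) ^ s * 𝓕(θ_ω(ξ))`, `ξ ∈ T`. -/
def discreteOp {n : ℕ} (m : Mesh a b) (F : IFS a b n) (r ν : ℕ) (s : ℝ) :
    (m.nodes r → ℝ) →ₗ[ℝ] (m.nodes r → ℝ) :=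
  LinearMap.pi fun ξ => ∑ ω : Fin ν → Fin n,
    (F.wordWeight (List.ofFn ω) ξ ^ s) • m.interp r (F.wordMap (List.ofFn ω) ξ)

/-- The matrix of the discrete operator. -/
def discreteMatrix {n : ℕ} (m : Mesh a b) (F : IFS a b n) (r ν : ℕ) (s : ℝ) :
    Matrix (m.nodes r) (m.nodes r) ℝ :=
  LinearMap.toMatrix' (m.discreteOp F r ν s)

/-- `R(𝐋_{s,ν})`: the largest modulus of a complex eigenvalue of the matrix. -/
def discreteRadius {n : ℕ} (m : Mesh a b) (F : IFS a b n) (r ν : ℕ) (s : ℝ) : ℝ :=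
  (spectralRadius ℂ ((m.discreteMatrix F r ν s).map (fun x : ℝ => (x : ℂ)))).toReal

/-- The cone `K(M; T) = {f : T → ℝ | f ξ ≤ exp (M |ξ - η|) f η}`. -/
def cone (m : Mesh a b) (r : ℕ) (M : ℝ) : Set (m.nodes r → ℝ) :=
  {f | ∀ ξ η : m.nodes r, f ξ ≤ Real.exp (M * |(ξ : ℝ) - η|) * f η}

/-- Consecutive intervals are far enough apart:
`2 sin² (π / (2 r + 2)) h_i ≤ lo (i + 1) - hi i`. -/
def GapCondition (m : Mesh a b) (r : ℕ) : Prop :=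
  ∀ i j : Fin m.I, (i : ℕ) + 1 = j →
    2 * Real.sin (Real.pi / (2 * r + 2)) ^ 2 * m.width i ≤ m.lo j - m.hi i

/-- `G = G_{r+1} = E exp(2 s h / χ) (1 / (r + 1)!) (1 / (2 cos(π / (2 r + 2)))) ^ (r + 1) / 2 ^ r`. -/
def G (m : Mesh a b) (r : ℕ) (s E χ : ℝ) : ℝ :=
  E * Real.exp (2 * s * m.h / χ) * (1 / (r + 1).factorial) *
    (1 / (2 * Real.cos (Real.pi / (2 * r + 2)))) ^ (r + 1) * (1 / 2 ^ r)

/-- `M₁ = μ G h ^ r / (1 - G² h ^ (2 r + 2)) / sin² (π / (2 r + 2)) + 2 s / χ`. -/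
def M₁ (m : Mesh a b) (r : ℕ) (s E χ : ℝ) : ℝ :=
  m.μ * (m.G r s E χ * m.h ^ r / (1 - m.G r s E χ ^ 2 * m.h ^ (2 * r + 2))) *
    (1 / Real.sin (Real.pi / (2 * r + 2))) ^ 2 + 2 * s / χ

/-- `M₂ = M₁ + (G / H) (μ / (1 - ((G / H) h)²)) / sin² (π / (2 r + 2))`. -/
def M₂ (m : Mesh a b) (r : ℕ) (s E χ H : ℝ) : ℝ :=
  m.M₁ r s E χ + m.G r s E χ / H * (m.μ / (1 - (m.G r s E χ / H * m.h) ^ 2)) *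
    (1 / Real.sin (Real.pi / (2 * r + 2)) ^ 2)

end Mesh

end TransferIFS

end

open Set TransferIFS

namespace TransferIFS

open Set

/-! ### Generalized Rolle theorem and the error of Lagrange interpolation -/

/-! Write A for the discrete operator, V for the eigenfunction sampled at the nodes, Λ = λ_s^ν, q =
G h^(r+1) and δ = H h^r. By the iterated eigenvalue equation (`sum_words_eq`), A V differs from Λ V
only through interpolation errors. Lagrange's error formula at Chebyshev points makes these small
relative to V (`abs_interp_sub_le`), so |A V - Λ V| ≤ q Λ V.

Were the entries of A nonnegative, this would bound the spectral radius at once, but Lagrange basis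
polynomials change sign. The order defined by the cone K(M; T), which A preserves by assumption,
replaces the pointwise order. The pointwise error has to be absorbed by that cone: distinct nodes
are at least 2σ² h_min apart (`nodes_separated`), so a relative perturbation of size q/δ = (G/H) h
raises the log-Lipschitz constant by about (q/δ)/(σ² h_min), for which M₂ leaves room
(`mem_cone_of_abs_sub_le`). The division by h_min costs one power of h, which is why the bounds
contain H h^r and not G h^(r+1).

Hence (1 - δ) Λ V ≤ A V ≤ (1 + δ) Λ V in the cone order. Iteration controls the powers of A, and
Gelfand's formula turns this into bounds for R(A) (`discreteRadius_bounds`). A weighted sup-norm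
estimate identifies λ_s with the eigenvalue of v (`lam_eq_of_pos_eigen`).

The comparison of matrices is independent of this: the entries of A are bounded uniformly in the
mesh (`abs_discreteMatrix_le`), and the two scalar factors differ by O(δ). -/

theorem exists_finset_zeros_of_hasDerivAt {α β : ℝ} {f f' : ℝ → ℝ}
    (hc : ContinuousOn f (Icc α β)) (hd : ∀ x ∈ Ioo α β, HasDerivAt f (f' x) x)
    (m : ℕ) (Z : Finset ℝ) (hZ : ∀ z ∈ Z, z ∈ Icc α β ∧ f z = 0) (hcard : Z.card = m + 1) :
    ∃ Z' : Finset ℝ, Z'.card = m ∧ ∀ z ∈ Z', z ∈ Ioo α β ∧ f' z = 0 := by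
  set e := Z.orderEmbOfFin hcard with he
  have hmem : ∀ i, e i ∈ Icc α β ∧ f (e i) = 0 := fun i => hZ _ (Z.orderEmbOfFin_mem hcard i)
  have hex : ∀ i : Fin m, ∃ x ∈ Ioo (e i.castSucc) (e i.succ), f' x = 0 := by
    intro i
    have hlt : e i.castSucc < e i.succ := e.strictMono i.castSucc_lt_succ
    refine exists_hasDerivAt_eq_zero hlt
      (hc.mono (Icc_subset_Icc (hmem _).1.1 (hmem _).1.2)) ?_ fun x hx => hd x ?_
    · rw [(hmem _).2, (hmem _).2]
    · exact ⟨(hmem _).1.1.trans_lt hx.1, hx.2.trans_le (hmem _).1.2⟩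
  choose ξ hξ hξ0 using hex
  -- Gaps between consecutive zeros overlap at most in an endpoint, and Rolle's points are interior,
  -- hence distinct.
  have hmono : StrictMono ξ := by
    intro i j hij
    have : e i.succ ≤ e j.castSucc := e.monotone (Fin.succ_le_castSucc_iff.2 hij)
    exact ((hξ i).2.trans_le this).trans (hξ j).1
  refine ⟨Finset.univ.image ξ, ?_, ?_⟩
  · rw [Finset.card_image_of_injective _ hmono.injective, Finset.card_univ, Fintype.card_fin]
  · intro z hz
    obtain ⟨i, -, rfl⟩ := Finset.mem_image.1 hz
    exact ⟨⟨(hmem _).1.1.trans_lt (hξ i).1, (hξ i).2.trans_le (hmem _).1.2⟩, hξ0 i⟩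

/-- Generalized Rolle theorem for a chain `φ 0, φ 1, …` of successive derivatives. -/
theorem exists_zero_of_deriv_chain {α β : ℝ} (m : ℕ) (φ : ℕ → ℝ → ℝ)
    (hc : ∀ k < m, ContinuousOn (φ k) (Icc α β))
    (hd : ∀ k < m, ∀ x ∈ Ioo α β, HasDerivAt (φ k) (φ (k + 1) x) x)
    (Z : Finset ℝ) (hZ : ∀ z ∈ Z, z ∈ Icc α β ∧ φ 0 z = 0) (hcard : Z.card = m + 1) :
    ∃ x ∈ Icc α β, φ m x = 0 := by
  induction m generalizing φ Z with
  | zero =>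
    obtain ⟨z, hz⟩ := Finset.card_pos.1 (by omega : 0 < Z.card)
    exact ⟨z, hZ z hz⟩
  | succ m ih =>
    obtain ⟨Z', hZ', h⟩ := exists_finset_zeros_of_hasDerivAt (hc 0 m.succ_pos)
      (hd 0 m.succ_pos) (m + 1) Z hZ hcard
    exact ih (fun k => φ (k + 1)) (fun k hk => hc _ (by omega)) (fun k hk => hd _ (by omega)) Z'
      (fun z hz => ⟨Ioo_subset_Icc_self (h z hz).1, (h z hz).2⟩) hZ'

/-- The error formula of Lagrange interpolation at `r + 1` points. -/
theorem exists_lagrange_error {a b α β : ℝ} (hab : a < b) {f : ℝ → ℝ} {r : ℕ}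
    (hf : ContDiffOn ℝ ((r + 1 : ℕ) : ℕ∞) f (Icc a b)) (hα : a ≤ α) (hβ : β ≤ b)
    {v : Fin (r + 1) → ℝ} (hinj : Function.Injective v) (hv : ∀ k, v k ∈ Icc α β)
    {x : ℝ} (hx : x ∈ Icc α β) :
    ∃ ξ ∈ Icc α β, f x - (Lagrange.interpolate Finset.univ v fun k => f (v k)).eval x
      = iteratedDerivWithin (r + 1) f (Icc a b) ξ / (r + 1).factorial * ∏ k, (x - v k) := by
  set p := Lagrange.interpolate Finset.univ v fun k => f (v k) with hp
  by_cases hxv : ∃ k, x = v k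
  · obtain ⟨k, rfl⟩ := hxv
    refine ⟨v k, hx, ?_⟩
    rw [Finset.prod_eq_zero (Finset.mem_univ k) (sub_self _), mul_zero, hp,
      Lagrange.eval_interpolate_at_node _ hinj.injOn (Finset.mem_univ k), sub_self]
  push Not at hxv
  set N := Lagrange.nodal Finset.univ v with hN
  have hNx : N.eval x = ∏ k, (x - v k) := Lagrange.eval_nodal
  have hNx0 : N.eval x ≠ 0 := by
    rw [hNx]; exact Finset.prod_ne_zero_iff.2 fun k _ => sub_ne_zero.2 (hxv k)
  -- K makes f - p - K N vanish at x as well as at the r + 1 nodes, which gives the r + 2 zeros for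
  -- the generalized Rolle theorem.
  set K := (f x - p.eval x) / N.eval x with hK
  set q := p + Polynomial.C K * N with hq
  -- The successive derivatives of f - q. Derivatives within [a, b] become ordinary ones at interior
  -- points, where alone Rolle needs them.
  set φ : ℕ → ℝ → ℝ := fun k y => iteratedDerivWithin k f (Icc a b) y
    - (Polynomial.derivative^[k] q).eval y with hφ
  have hU := uniqueDiffOn_Icc hab
  have hsub : Icc α β ⊆ Icc a b := Icc_subset_Icc hα hβ
  have hdiff : ∀ k < r + 1, DifferentiableOn ℝ (iteratedDerivWithin k f (Icc a b)) (Icc a b) :=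
    fun k hk => hf.differentiableOn_iteratedDerivWithin (by exact_mod_cast hk) hU
  have hNcard : N.natDegree = r + 1 := by simp [hN, Lagrange.natDegree_nodal]
  have hpdeg : p.degree < ((r + 1 : ℕ) : WithBot ℕ) := by
    have := Lagrange.degree_interpolate_lt (s := Finset.univ) (fun k => f (v k)) hinj.injOn
    rwa [Finset.card_univ, Fintype.card_fin] at this
  have hqd : ∀ y, (Polynomial.derivative^[r + 1] q).eval y = K * (r + 1).factorial := by
    intro y
    have h1 : Polynomial.derivative^[r + 1] p = 0 :=
      Polynomial.iterate_derivative_eq_zero_of_degree_lt hpdeg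
    have h2 : Polynomial.derivative^[r + 1] N = Polynomial.C (((r + 1).factorial : ℕ) : ℝ) := by
      have h3 : (Polynomial.derivative^[r + 1] N).natDegree = 0 := by
        have := Polynomial.natDegree_iterate_derivative N (r + 1)
        omega
      rw [Polynomial.eq_C_of_natDegree_eq_zero h3, Polynomial.coeff_iterate_derivative]
      have h4 : N.coeff (0 + (r + 1)) = 1 := by
        rw [zero_add, ← hNcard]
        exact Lagrange.nodal_monic
      rw [h4, zero_add, Nat.descFactorial_self]
      simp
    rw [hq, iterate_map_add, Polynomial.iterate_derivative_C_mul, h1, h2]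
    simp
  have hv0 : ∀ k, φ 0 (v k) = 0 := by
    intro k
    have h1 : p.eval (v k) = f (v k) :=
      Lagrange.eval_interpolate_at_node _ hinj.injOn (Finset.mem_univ k)
    have h2 : N.eval (v k) = 0 := Lagrange.eval_nodal_at_node (Finset.mem_univ k)
    simp [hφ, hq, h1, h2]
  have hx0 : φ 0 x = 0 := by
    simp [hφ, hq, hK, div_mul_cancel₀ _ hNx0]
  obtain ⟨ξ, hξ, h0⟩ := exists_zero_of_deriv_chain (α := α) (β := β) (r + 1) φ
    (fun k hk => ((hdiff k hk).continuousOn.mono hsub).sub (Polynomial.continuousOn _))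
    (by
      intro k hk y hy
      have hnhds : Icc a b ∈ nhds y :=
        Icc_mem_nhds (hα.trans_lt hy.1) (hy.2.trans_le hβ)
      have h1 : HasDerivAt (iteratedDerivWithin k f (Icc a b))
          (iteratedDerivWithin (k + 1) f (Icc a b) y) y := by
        rw [iteratedDerivWithin_succ]
        exact ((hdiff k hk y (mem_of_mem_nhds hnhds)).hasDerivWithinAt).hasDerivAt hnhds
      have h2 := (Polynomial.derivative^[k] q).hasDerivAt y
      rw [← Function.iterate_succ_apply' Polynomial.derivative] at h2
      exact h1.sub h2)
    (insert x (Finset.univ.image v))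
    (by
      intro z hz
      rcases Finset.mem_insert.1 hz with rfl | hz
      · exact ⟨hx, hx0⟩
      · obtain ⟨k, -, rfl⟩ := Finset.mem_image.1 hz
        exact ⟨hv k, hv0 k⟩)
    (by
      rw [Finset.card_insert_of_notMem, Finset.card_image_of_injective _ hinj]
      · simp
      · simpa using fun k hk => hxv k hk.symm)
  refine ⟨ξ, hξ, ?_⟩
  have h1 : iteratedDerivWithin (r + 1) f (Icc a b) ξ = K * (r + 1).factorial := by
    rw [← hqd ξ]; exact sub_eq_zero.1 h0
  rw [h1, ← hNx, mul_div_assoc, div_self (by positivity), mul_one, hK, div_mul_cancel₀ _ hNx0]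

/-! ### Chebyshev points -/

/-- These cosines are all the roots of the Chebyshev polynomial of degree r + 1, whose leading
coefficient is 2^r. -/
theorem prod_sub_cos_eq_eval_T (r : ℕ) (y : ℝ) :
    ∏ k : Fin (r + 1), (y - Real.cos ((2 * k + 1) / (2 * r + 2) * Real.pi))
      = (Polynomial.Chebyshev.T ℝ (r + 1 : ℕ)).eval y / 2 ^ r := by
  have hroots := Polynomial.Chebyshev.roots_T_real (r + 1)
  have hinj : ((Finset.range (r + 1)).image
      (fun k : ℕ => Real.cos ((2 * k + 1) * Real.pi / (2 * (r + 1 : ℕ))))).val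
      = Multiset.map (fun k : ℕ => Real.cos ((2 * k + 1) * Real.pi / (2 * (r + 1 : ℕ))))
        (Multiset.range (r + 1)) := by
    rw [Finset.image_val, Finset.range_val, Multiset.dedup_eq_self]
    exact Polynomial.Chebyshev.roots_T_real_nodup (r + 1)
  rw [hinj] at hroots
  have hdeg : Multiset.card (Polynomial.Chebyshev.T ℝ (r + 1 : ℕ)).roots
      = (Polynomial.Chebyshev.T ℝ (r + 1 : ℕ)).natDegree := by
    rw [hroots, Polynomial.Chebyshev.natDegree_T]
    simp
    omega
  have h := Polynomial.C_leadingCoeff_mul_prod_multiset_X_sub_C hdeg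
  rw [Polynomial.Chebyshev.leadingCoeff_T, hroots] at h
  rw [← h]
  simp only [Polynomial.eval_mul, Polynomial.eval_C, Polynomial.eval_multiset_prod,
    Multiset.map_map, Function.comp_def, Polynomial.eval_sub, Polynomial.eval_X]
  have hn : ((r + 1 : ℕ) : ℤ).natAbs - 1 = r := by omega
  rw [hn, mul_div_cancel_left₀ _ (by positivity)]
  rw [Fin.prod_univ_eq_prod_range
    (fun k : ℕ => y - Real.cos ((2 * (k : ℝ) + 1) / (2 * r + 2) * Real.pi)) (r + 1)]
  change _ = (Finset.prod (Finset.range (r + 1)) _)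
  refine Finset.prod_congr rfl fun k _ => ?_
  congr 2
  push_cast
  ring

theorem sin_le_sin_of_le_of_le_pi_sub {t x : ℝ} (h0 : 0 ≤ t) (h1 : t ≤ x) (h2 : x ≤ Real.pi - t) :
    Real.sin t ≤ Real.sin x := by
  rcases le_total x (Real.pi / 2) with h | h
  · exact Real.sin_le_sin_of_le_of_le_pi_div_two (by linarith) h h1
  · rw [← Real.sin_pi_sub x]
    exact Real.sin_le_sin_of_le_of_le_pi_div_two (by linarith) (by linarith) (by linarith)

/-- Distinct Chebyshev points are at distance at least `4 sin² (π / (2 r + 2)) cos (π / (2 r + 2))`. -/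
theorem cos_sub_cos_ge {r : ℕ} {j k : ℕ} (hjk : j < k) (hk : k ≤ r) :
    4 * Real.sin (Real.pi / (2 * r + 2)) ^ 2 * Real.cos (Real.pi / (2 * r + 2))
      ≤ Real.cos ((2 * j + 1) / (2 * r + 2) * Real.pi)
        - Real.cos ((2 * k + 1) / (2 * r + 2) * Real.pi) := by
  set α := Real.pi / (2 * r + 2) with hα
  have hr : (1 : ℝ) ≤ r := by exact_mod_cast (by omega : 1 ≤ r)
  have hα0 : 0 < α := by have := Real.pi_pos; positivity
  have hπ : Real.pi = (2 * r + 2) * α := by rw [hα]; field_simp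
  have hj0 : (0 : ℝ) ≤ j := Nat.cast_nonneg j
  have hjk' : (j : ℝ) + 1 ≤ k := by exact_mod_cast hjk
  have hk' : (k : ℝ) ≤ r := by exact_mod_cast hk
  have e1 : (2 * (j : ℝ) + 1) / (2 * r + 2) * Real.pi = (2 * j + 1) * α := by rw [hα]; ring
  have e2 : (2 * (k : ℝ) + 1) / (2 * r + 2) * Real.pi = (2 * k + 1) * α := by rw [hα]; ring
  rw [e1, e2, Real.cos_sub_cos]
  have e3 : ((2 * (j : ℝ) + 1) * α + (2 * k + 1) * α) / 2 = (j + k + 1) * α := by ring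
  have e4 : ((2 * (j : ℝ) + 1) * α - (2 * k + 1) * α) / 2 = -((k - j) * α) := by ring
  rw [e3, e4, Real.sin_neg]
  -- Here 2 ≤ j + k + 1 ≤ 2r and 1 ≤ k - j ≤ r, while π = (2r + 2) α. So the two angles keep
  -- distance 2α and α from both 0 and π.
  have h1 : Real.sin (2 * α) ≤ Real.sin ((j + k + 1) * α) := by
    apply sin_le_sin_of_le_of_le_pi_sub <;> nlinarith
  have h2 : Real.sin α ≤ Real.sin ((k - j) * α) := by
    apply sin_le_sin_of_le_of_le_pi_sub <;> nlinarith
  have h3 : 0 ≤ Real.sin α := Real.sin_nonneg_of_nonneg_of_le_pi hα0.le (by nlinarith)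
  have h4 : 0 ≤ Real.sin (2 * α) :=
    Real.sin_nonneg_of_nonneg_of_le_pi (by linarith) (by nlinarith)
  have h5 := mul_le_mul h1 h2 h3 (h4.trans h1)
  rw [Real.sin_two_mul] at h5
  nlinarith

namespace Mesh

variable {a b : ℝ}

/-! ### Geometry of the mesh -/

theorem sin_pos {r : ℕ} : 0 < Real.sin (Real.pi / (2 * r + 2)) := by
  have hp := Real.pi_pos
  apply Real.sin_pos_of_pos_of_lt_pi (by positivity)
  rw [div_lt_iff₀ (by positivity)]
  nlinarith [(Nat.cast_nonneg r : (0 : ℝ) ≤ r)]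

/-- The factor cos(π / (2r + 2)) in the cosine gap cancels against the stretching that moves the
extreme Chebyshev points to the ends of the piece. -/
theorem node_sub_node_ge (m : Mesh a b) {r : ℕ} (hr : 1 ≤ r) (i : Fin m.I) (j : Fin (m.N i))
    {k l : Fin (r + 1)} (hkl : k < l) :
    2 * Real.sin (Real.pi / (2 * r + 2)) ^ 2 * m.width i ≤ m.node r i j l - m.node r i j k := by
  have hc := cos_pos hr
  have h := cos_sub_cos_ge (r := r) (j := k) (k := l) hkl (Nat.lt_succ_iff.1 l.2)
  have hw := m.width_pos i
  unfold node
  set c := Real.cos (Real.pi / (2 * r + 2))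
  set x := Real.cos ((2 * ((k : ℕ) : ℝ) + 1) / (2 * r + 2) * Real.pi)
  set y := Real.cos ((2 * ((l : ℕ) : ℝ) + 1) / (2 * r + 2) * Real.pi)
  set t := Real.sin (Real.pi / (2 * r + 2)) ^ 2
  have h1 : 4 * t ≤ (x - y) / c := by rwa [le_div_iff₀ hc]
  have h2 : m.left i j + m.width i / 2 * (1 - y / c) - (m.left i j + m.width i / 2 * (1 - x / c))
      = m.width i / 2 * ((x - y) / c) := by ring
  rw [h2]
  nlinarith

theorem node_mem_Icc (m : Mesh a b) {r : ℕ} (hr : 1 ≤ r) (i : Fin m.I) (j : Fin (m.N i))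
    (k : Fin (r + 1)) : m.node r i j k ∈ Icc (m.left i j) (m.right i j) := by
  have hw := m.width_pos i
  have hp : 0 ≤ 2 * Real.sin (Real.pi / (2 * r + 2)) ^ 2 * m.width i := by positivity
  constructor
  · rw [← m.node_zero hr]
    rcases (Fin.zero_le k).eq_or_lt with h | h
    · rw [← h]
    · linarith [m.node_sub_node_ge hr i j h]
  · rw [← m.node_last hr]
    rcases (Fin.le_last k).eq_or_lt with h | h
    · rw [h]
    · linarith [m.node_sub_node_ge hr i j h]

theorem right_sub_left (m : Mesh a b) (i : Fin m.I) (j : Fin (m.N i)) :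
    m.right i j - m.left i j = m.width i := by
  unfold right left; ring

theorem cell_subset (m : Mesh a b) (i : Fin m.I) (j : Fin (m.N i)) :
    Icc (m.left i j) (m.right i j) ⊆ Icc a b :=
  Icc_subset_Icc ((m.le_lo i).trans (m.lo_le_left i j)) ((m.right_le_hi i j).trans (m.hi_le i))

theorem nodes_subset (m : Mesh a b) {r : ℕ} (hr : 1 ≤ r) {ξ : ℝ} (hξ : ξ ∈ m.nodes r) :
    ξ ∈ Icc a b := by
  obtain ⟨⟨i, j, k⟩, -, rfl⟩ := Finset.mem_image.1 hξ
  exact m.cell_subset i j (m.node_mem_Icc hr i j k)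

theorem width_le_h (m : Mesh a b) (i : Fin m.I) : m.width i ≤ m.h :=
  le_ciSup (Set.finite_range _).bddAbove i

theorem hmin_le_width (m : Mesh a b) (i : Fin m.I) : m.hmin ≤ m.width i :=
  ciInf_le (Set.finite_range _).bddBelow i

theorem h_pos (m : Mesh a b) (i : Fin m.I) : 0 < m.h := (m.width_pos i).trans_le (m.width_le_h i)

theorem hmin_pos (m : Mesh a b) (i : Fin m.I) : 0 < m.hmin := by
  have : Nonempty (Fin m.I) := ⟨i⟩
  obtain ⟨j, hj⟩ := exists_eq_ciInf_of_finite (f := m.width)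
  have : m.hmin = m.width j := hj.symm
  rw [this]
  exact m.width_pos j

theorem exists_cell (m : Mesh a b) (i : Fin m.I) {x : ℝ} (hx : x ∈ Icc (m.lo i) (m.hi i)) :
    ∃ j, x ∈ Icc (m.left i j) (m.right i j) := by
  have hw := m.width_pos i
  have hN : (0 : ℝ) < m.N i := Nat.cast_pos.2 (m.N_pos i)
  have hhi : m.hi i = m.lo i + m.N i * m.width i := by
    unfold width; field_simp; ring
  -- At the right endpoint the floor would be N i, one too many; that point belongs to the last
  -- piece.
  rcases hx.2.eq_or_lt with h | h
  · refine ⟨⟨m.N i - 1, Nat.sub_lt (m.N_pos i) one_pos⟩, ?_⟩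
    have hc : ((m.N i - 1 : ℕ) : ℝ) = m.N i - 1 := by
      rw [Nat.cast_sub (m.N_pos i)]; simp
    simp only [left, right, hc, mem_Icc]
    constructor <;> nlinarith
  · have h0 : 0 ≤ (x - m.lo i) / m.width i := div_nonneg (by linarith [hx.1]) hw.le
    have hlt : ⌊(x - m.lo i) / m.width i⌋₊ < m.N i := by
      rw [Nat.floor_lt h0, div_lt_iff₀ hw]; linarith
    refine ⟨⟨_, hlt⟩, ?_⟩
    have h1 := Nat.floor_le h0
    have h2 := (Nat.lt_floor_add_one ((x - m.lo i) / m.width i)).le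
    rw [le_div_iff₀ hw] at h1
    rw [div_le_iff₀ hw] at h2
    simp only [left, right, mem_Icc]
    constructor <;> linarith

theorem lo_sub_hi_ge (m : Mesh a b) {r : ℕ} (hgap : m.GapCondition r) {i j : Fin m.I}
    (hij : i < j) :
    2 * Real.sin (Real.pi / (2 * r + 2)) ^ 2 * m.width i ≤ m.lo j - m.hi i := by
  have hlt : (i : ℕ) + 1 < m.I := by omega
  have h := hgap i ⟨i + 1, hlt⟩ rfl
  have hle : m.lo ⟨i + 1, hlt⟩ ≤ m.lo j := by
    rcases (show (⟨i + 1, hlt⟩ : Fin m.I) ≤ j from hij).eq_or_lt with h' | h'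
    · rw [h']
    · exact (m.lo_lt_hi _).le.trans (m.hi_lt_lo _ _ h').le
  linarith

/-- Unless both nodes are the facing ends of their pieces, a gap inside one piece already suffices.
If both are, being distinct they have a whole piece between them, and its width is at least the gap
between its own end nodes. -/
theorem node_sub_node_ge_of_cell_lt (m : Mesh a b) {r : ℕ} (hr : 1 ≤ r) (i : Fin m.I)
    {j j' : Fin (m.N i)} (hlt : j < j') {k k' : Fin (r + 1)}
    (hne : m.node r i j k ≠ m.node r i j' k') :
    2 * Real.sin (Real.pi / (2 * r + 2)) ^ 2 * m.width i
      ≤ m.node r i j' k' - m.node r i j k := by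
  have hw := m.width_pos i
  have hlast : (0 : Fin (r + 1)) < Fin.last r := by
    rw [Fin.lt_def]; simpa using by omega
  have h1 : ((j : ℕ) : ℝ) + 1 ≤ ((j' : ℕ) : ℝ) := by exact_mod_cast hlt
  have h2 : m.right i j ≤ m.left i j' := by
    have := mul_le_mul_of_nonneg_right h1 hw.le
    unfold right left
    linarith
  have h3 := (m.node_mem_Icc hr i j k).2
  have h4 := (m.node_mem_Icc hr i j' k').1
  rcases (Fin.le_last k).eq_or_lt with hk | hk
  · rcases (Fin.zero_le k').eq_or_lt with hk' | hk'
    · subst hk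
      subst hk'
      rw [m.node_last hr, m.node_zero hr] at hne ⊢
      have h5 : ((j : ℕ) : ℝ) + 2 ≤ ((j' : ℕ) : ℝ) := by
        have : (j : ℕ) + 1 ≠ j' := by
          intro h
          apply hne
          unfold left right
          rw [← h]; push_cast; ring
        have h6 : (j : ℕ) < j' := hlt
        exact_mod_cast (by omega : (j : ℕ) + 2 ≤ j')
      have h6 := m.node_sub_node_ge hr i j hlast
      rw [m.node_last hr, m.node_zero hr, m.right_sub_left] at h6
      have := mul_le_mul_of_nonneg_right h5 hw.le
      unfold left right
      linarith
    · have h5 := m.node_sub_node_ge hr i j' hk'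
      rw [m.node_zero hr] at h5
      linarith
  · have h5 := m.node_sub_node_ge hr i j hk
    rw [m.node_last hr] at h5
    linarith

/-- Distinct nodes are at distance at least `2 sin² (π / (2 r + 2)) h_min`. -/
theorem nodes_separated (m : Mesh a b) {r : ℕ} (hr : 1 ≤ r) (hgap : m.GapCondition r)
    {ξ η : ℝ} (hξ : ξ ∈ m.nodes r) (hη : η ∈ m.nodes r) (hne : ξ ≠ η) :
    2 * Real.sin (Real.pi / (2 * r + 2)) ^ 2 * m.hmin ≤ |ξ - η| := by
  have hmin : ∀ i, 2 * Real.sin (Real.pi / (2 * r + 2)) ^ 2 * m.hmin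
      ≤ 2 * Real.sin (Real.pi / (2 * r + 2)) ^ 2 * m.width i :=
    fun i => mul_le_mul_of_nonneg_left (m.hmin_le_width i) (by positivity)
  have hfar : ∀ i i' j j' k k', i < i' →
      2 * Real.sin (Real.pi / (2 * r + 2)) ^ 2 * m.hmin
        ≤ m.node r i' j' k' - m.node r i j k := by
    intro i i' j j' k k' hlt
    have h1 := (m.node_mem_Icc hr i j k).2.trans (m.right_le_hi i j)
    have h2 := (m.lo_le_left i' j').trans (m.node_mem_Icc hr i' j' k').1
    have h3 := m.lo_sub_hi_ge hgap hlt
    linarith [hmin i]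
  obtain ⟨⟨i, j, k⟩, -, rfl⟩ := Finset.mem_image.1 hξ
  obtain ⟨⟨i', j', k'⟩, -, rfl⟩ := Finset.mem_image.1 hη
  simp only at hne ⊢
  rcases lt_trichotomy i i' with h | h | h
  · rw [abs_sub_comm]
    exact (hfar _ _ _ _ _ _ h).trans (le_abs_self _)
  · subst h
    refine (hmin i).trans ?_
    rcases lt_trichotomy j j' with h | h | h
    · rw [abs_sub_comm]
      exact (m.node_sub_node_ge_of_cell_lt hr i h hne).trans (le_abs_self _)
    · subst h
      rcases lt_trichotomy k k' with h | h | h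
      · rw [abs_sub_comm]
        exact (m.node_sub_node_ge hr i j h).trans (le_abs_self _)
      · exact absurd (by rw [h]) hne
      · exact (m.node_sub_node_ge hr i j h).trans (le_abs_self _)
    · exact (m.node_sub_node_ge_of_cell_lt hr i h hne.symm).trans (le_abs_self _)
  · exact (hfar _ _ _ _ _ _ h).trans (le_abs_self _)

/-! ### Bounds for the interpolation operator -/

theorem abs_prod_sub_node_le (m : Mesh a b) {r : ℕ} (hr : 1 ≤ r) (i : Fin m.I) (j : Fin (m.N i))
    {x : ℝ} (hx : x ∈ Icc (m.left i j) (m.right i j)) :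
    |∏ k, (x - m.node r i j k)|
      ≤ m.width i ^ (r + 1) * (1 / (2 * Real.cos (Real.pi / (2 * r + 2)))) ^ (r + 1)
        * (1 / 2 ^ r) := by
  have hc := cos_pos hr
  have hw := m.width_pos i
  have hlr := m.right_sub_left i j
  set c := Real.cos (Real.pi / (2 * r + 2))
  have hc1 : c ≤ 1 := Real.cos_le_one _
  set w := m.width i
  -- Affine coordinate that takes the piece to [-c, c] and the nodes to the Chebyshev roots. The
  -- product becomes a Chebyshev polynomial, bounded by 1 there.
  set y := c * (1 - 2 * ((x - m.left i j) / w)) with hy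
  have hterm : ∀ k : Fin (r + 1), x - m.node r i j k = -(w * (1 / (2 * c)))
      * (y - Real.cos ((2 * k + 1) / (2 * r + 2) * Real.pi)) := by
    intro k
    unfold node
    rw [hy]
    change _ - (_ + w / 2 * (1 - _ / c)) = _
    field_simp
    ring
  have hy1 : |y| ≤ 1 := by
    have h0 : 0 ≤ (x - m.left i j) / w := div_nonneg (by linarith [hx.1]) hw.le
    have h1 : (x - m.left i j) / w ≤ 1 := by rw [div_le_one hw]; linarith [hx.2]
    rw [hy, abs_mul, abs_of_pos hc]
    have : |1 - 2 * ((x - m.left i j) / w)| ≤ 1 := by rw [abs_le]; constructor <;> linarith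
    nlinarith [abs_nonneg (1 - 2 * ((x - m.left i j) / w))]
  simp_rw [hterm]
  rw [Finset.prod_mul_distrib, Finset.prod_const, prod_sub_cos_eq_eval_T, Finset.card_univ,
    Fintype.card_fin, abs_mul, abs_pow, abs_neg, abs_of_pos (by positivity : 0 < w * (1 / (2 * c))),
    mul_pow, abs_div, abs_of_pos (by positivity : (0 : ℝ) < 2 ^ r)]
  apply mul_le_mul_of_nonneg_left _ (by positivity)
  gcongr
  exact Polynomial.Chebyshev.abs_eval_T_real_le_one _ hy1

/-- The relative interpolation error of a function whose derivative of order `r + 1` is bounded by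
a multiple of the function. -/
theorem abs_interp_sub_le (hab : a < b) (m : Mesh a b) {r : ℕ} (hr : 1 ≤ r) {v : ℝ → ℝ}
    (hv : ContDiffOn ℝ ((r + 1 : ℕ) : ℕ∞) v (Icc a b)) (hpos : ∀ t ∈ Icc a b, 0 < v t)
    {s E χ : ℝ} (hs : 0 < s) (hχ : 0 < χ)
    (hE : ∀ x ∈ Icc a b, |iteratedDerivWithin (r + 1) v (Icc a b) x| / v x ≤ E)
    (hlip : ∀ x₁ ∈ Icc a b, ∀ x₂ ∈ Icc a b, v x₁ ≤ v x₂ * Real.exp (2 * s * |x₁ - x₂| / χ))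
    (i : Fin m.I) {x : ℝ} (hx : x ∈ Icc (m.lo i) (m.hi i)) :
    |m.interp r x (fun ξ => v ξ) - v x| ≤ m.G r s E χ * m.h ^ (r + 1) * v x := by
  obtain ⟨j, hj⟩ := m.exists_cell i hx
  have hxS := m.cell_subset i j hj
  rw [m.interp_eq hr i j hj]
  obtain ⟨ξ, hξ, herr⟩ := exists_lagrange_error hab hv
    ((m.le_lo i).trans (m.lo_le_left i j)) ((m.right_le_hi i j).trans (m.hi_le i))
    (m.node_injective hr i j) (m.node_mem_Icc hr i j) hj
  have hcell : m.cellPoly r i j (fun ξ => v ξ)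
      = Lagrange.interpolate Finset.univ (m.node r i j) fun k => v (m.node r i j k) := rfl
  have hξS := m.cell_subset i j hξ
  have hwh := m.width_le_h i
  have hw := m.width_pos i
  have hc := cos_pos hr
  have hE0 : 0 ≤ E := (div_nonneg (abs_nonneg _) (hpos x hxS).le).trans (hE x hxS)
  -- The bound E is relative to v at the unknown point ξ. Moving the reference to x, within h in the
  -- same piece, produces the exponential factor in G.
  have hd : |iteratedDerivWithin (r + 1) v (Icc a b) ξ|
      ≤ E * (v x * Real.exp (2 * s * m.h / χ)) := by
    have h1 := hE ξ hξS
    rw [div_le_iff₀ (hpos ξ hξS)] at h1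
    refine h1.trans (mul_le_mul_of_nonneg_left ((hlip ξ hξS x hxS).trans ?_) hE0)
    apply mul_le_mul_of_nonneg_left _ (hpos x hxS).le
    apply Real.exp_le_exp.2
    have h2 : |ξ - x| ≤ m.h := by
      have := m.right_sub_left i j
      rw [abs_le]
      constructor <;> linarith [hξ.1, hξ.2, hj.1, hj.2]
    gcongr
  rw [hcell, abs_sub_comm, herr, abs_mul, abs_div, Nat.abs_cast]
  calc _ ≤ E * (v x * Real.exp (2 * s * m.h / χ)) / ((r + 1).factorial : ℝ)
        * (m.h ^ (r + 1) * (1 / (2 * Real.cos (Real.pi / (2 * r + 2)))) ^ (r + 1)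
        * (1 / 2 ^ r)) := by
        refine mul_le_mul (by gcongr) ((m.abs_prod_sub_node_le hr i j hj).trans ?_)
          (abs_nonneg _) ?_
        · gcongr
        · have := hpos x hxS
          positivity
    _ = _ := by
        unfold G
        ring

/-- Each of the r factors has numerator at most the width and denominator at least 2σ² times the
width, so the mesh size drops out. -/
theorem abs_eval_basis_le (m : Mesh a b) {r : ℕ} (hr : 1 ≤ r) (i : Fin m.I) (j : Fin (m.N i))
    {x : ℝ} (hx : x ∈ Icc (m.left i j) (m.right i j)) (k : Fin (r + 1)) :
    |(Lagrange.basis Finset.univ (m.node r i j) k).eval x|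
      ≤ (1 / (2 * Real.sin (Real.pi / (2 * r + 2)) ^ 2)) ^ r := by
  have hσ : 0 < 2 * Real.sin (Real.pi / (2 * r + 2)) ^ 2 := by
    have := sin_pos (r := r)
    positivity
  have hw := m.width_pos i
  have hlr := m.right_sub_left i j
  have hcard : (Finset.univ.erase k).card = r := by
    rw [Finset.card_erase_of_mem (Finset.mem_univ k), Finset.card_univ, Fintype.card_fin]
    rfl
  rw [Lagrange.basis, Polynomial.eval_prod, Finset.abs_prod]
  refine le_trans (b := ∏ _l ∈ Finset.univ.erase k,
    1 / (2 * Real.sin (Real.pi / (2 * r + 2)) ^ 2)) ?_ (by rw [Finset.prod_const, hcard])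
  refine Finset.prod_le_prod (fun _ _ => abs_nonneg _) fun l hl => ?_
  have hlk : l ≠ k := Finset.ne_of_mem_erase hl
  have h1 : 2 * Real.sin (Real.pi / (2 * r + 2)) ^ 2 * m.width i
      ≤ |m.node r i j k - m.node r i j l| := by
    rcases lt_or_gt_of_ne hlk with h | h
    · exact (m.node_sub_node_ge hr i j h).trans (le_abs_self _)
    · rw [abs_sub_comm]
      exact (m.node_sub_node_ge hr i j h).trans (le_abs_self _)
  have h2 : |x - m.node r i j l| ≤ m.width i := by
    have := m.node_mem_Icc hr i j l
    rw [abs_le]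
    constructor <;> linarith [hx.1, hx.2, this.1, this.2]
  have h3 : 0 < |m.node r i j k - m.node r i j l| := (mul_pos hσ hw).trans_le h1
  rw [Lagrange.basisDivisor, Polynomial.eval_mul, Polynomial.eval_C, Polynomial.eval_sub,
    Polynomial.eval_X, Polynomial.eval_C, abs_mul, abs_inv, inv_mul_le_iff₀ h3]
  refine h2.trans ?_
  rw [mul_one_div, le_div_iff₀ hσ]
  linarith

/-- The interpolation operator has norm at most `(r + 1) (2 sin² (π / (2 r + 2))) ^ (-r)`. -/
theorem abs_interp_le (m : Mesh a b) {r : ℕ} (hr : 1 ≤ r) (i : Fin m.I)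
    {x : ℝ} (hx : x ∈ Icc (m.lo i) (m.hi i)) {f : m.nodes r → ℝ} (hf : ∀ ξ, |f ξ| ≤ 1) :
    |m.interp r x f| ≤ (r + 1) * (1 / (2 * Real.sin (Real.pi / (2 * r + 2)) ^ 2)) ^ r := by
  obtain ⟨j, hj⟩ := m.exists_cell i hx
  rw [m.interp_eq hr i j hj]
  have hcell : m.cellPoly r i j f = Lagrange.interpolate Finset.univ (m.node r i j)
      fun k => f ⟨m.node r i j k, m.node_mem r i j k⟩ := rfl
  rw [hcell, Lagrange.interpolate_apply, Polynomial.eval_finsetSum]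
  refine (Finset.abs_sum_le_sum_abs _ _).trans ?_
  calc _ ≤ ∑ _k : Fin (r + 1), (1 / (2 * Real.sin (Real.pi / (2 * r + 2)) ^ 2)) ^ r := by
        refine Finset.sum_le_sum fun k _ => ?_
        rw [Polynomial.eval_mul, Polynomial.eval_C, abs_mul]
        have := m.abs_eval_basis_le hr i j hj k
        nlinarith [hf ⟨m.node r i j k, m.node_mem r i j k⟩,
          abs_nonneg ((Lagrange.basis Finset.univ (m.node r i j) k).eval x)]
    _ = _ := by simp

end Mesh

open Filter Topology

/-! ### Spectral radius and growth of powers -/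

section Gelfand

variable {A : Type*} [NormedRing A] [NormedAlgebra ℂ A] [CompleteSpace A]

theorem tendsto_rpow_one_div_mul {c : ℝ} (hc : 0 < c) (β : ℝ) :
    Tendsto (fun k : ℕ => ENNReal.ofReal (c ^ (1 / k : ℝ) * β)) atTop
      (𝓝 (ENNReal.ofReal β)) := by
  apply ENNReal.tendsto_ofReal
  have h1 : Tendsto (fun k : ℕ => c ^ (1 / k : ℝ)) atTop (𝓝 (c ^ (0 : ℝ))) :=
    (Real.continuousAt_const_rpow hc.ne').tendsto.comp tendsto_one_div_atTop_nhds_zero_nat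
  simpa using h1.mul_const β

theorem mul_pow_rpow_one_div {c β : ℝ} (hc : 0 < c) (hβ : 0 ≤ β) {k : ℕ} (hk : k ≠ 0) :
    (c * β ^ k) ^ (1 / k : ℝ) = c ^ (1 / k : ℝ) * β := by
  rw [Real.mul_rpow hc.le (pow_nonneg hβ k), one_div, Real.pow_rpow_inv_natCast hβ hk]

theorem spectralRadius_toReal_le_of_norm_pow_le (x : A) {C β : ℝ} (hβ : 0 ≤ β)
    (h : ∀ k, ‖x ^ k‖ ≤ C * β ^ k) : (spectralRadius ℂ x).toReal ≤ β := by
  apply ENNReal.toReal_le_of_le_ofReal hβ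
  refine le_of_tendsto_of_tendsto (spectrum.pow_norm_pow_one_div_tendsto_nhds_spectralRadius x)
    (tendsto_rpow_one_div_mul (lt_max_of_lt_right one_pos : 0 < max C 1) β) ?_
  filter_upwards [eventually_ne_atTop 0] with k hk
  rw [← mul_pow_rpow_one_div (lt_max_of_lt_right one_pos) hβ hk]
  apply ENNReal.ofReal_le_ofReal
  apply Real.rpow_le_rpow (norm_nonneg _) _ (by positivity)
  exact (h k).trans (mul_le_mul_of_nonneg_right (le_max_left _ _) (pow_nonneg hβ k))

theorem le_spectralRadius_toReal_of_le_norm_pow (x : A) {c α : ℝ} (hc : 0 < c) (hα : 0 ≤ α)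
    (h : ∀ k, c * α ^ k ≤ ‖x ^ k‖) : α ≤ (spectralRadius ℂ x).toReal := by
  -- Needed for a lower bound because `ENNReal.toReal` sends ⊤ to 0.
  have htop : spectralRadius ℂ x ≠ ⊤ := by
    have := spectrum.spectralRadius_le_pow_nnnorm_pow_one_div ℂ x 0
    refine ne_top_of_le_ne_top ?_ this
    simp only [Nat.cast_zero, zero_add, div_one, ENNReal.rpow_one]
    exact ENNReal.mul_ne_top ENNReal.coe_ne_top ENNReal.coe_ne_top
  rw [← ENNReal.ofReal_le_iff_le_toReal htop]
  refine le_of_tendsto_of_tendsto (tendsto_rpow_one_div_mul hc α)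
    (spectrum.pow_norm_pow_one_div_tendsto_nhds_spectralRadius x) ?_
  filter_upwards [eventually_ne_atTop 0] with k hk
  rw [← mul_pow_rpow_one_div hc hα hk]
  apply ENNReal.ofReal_le_ofReal
  exact Real.rpow_le_rpow (by positivity) (h k) (by positivity)

end Gelfand

/-! ### Growth criteria for the spectral radius of a real matrix -/

section Matrix

variable {ι : Type*} [Fintype ι] [DecidableEq ι]

attribute [local instance] Matrix.linftyOpNormedRing Matrix.linftyOpNormedAlgebra

theorem toMatrix'_pow_mulVec (L : (ι → ℝ) →ₗ[ℝ] (ι → ℝ)) (k : ℕ) (f : ι → ℝ) :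
    (LinearMap.toMatrix' L ^ k).mulVec f = (L ^ k) f := by
  induction k with
  | zero => simp
  | succ k ih =>
    rw [pow_succ', ← Matrix.mulVec_mulVec, ih, LinearMap.toMatrix'_mulVec, pow_succ']
    rfl

theorem map_ofReal_pow (B : Matrix ι ι ℝ) (k : ℕ) :
    (B.map (fun x : ℝ => (x : ℂ))) ^ k = (B ^ k).map (fun x : ℝ => (x : ℂ)) :=
  (map_pow (RingHom.mapMatrix Complex.ofRealHom) B k).symm

/-- Columns of the k-th power are images of unit vectors, so growth bounds for single vectors
control the row-sum norm. -/
theorem matrix_spectralRadius_le (L : (ι → ℝ) →ₗ[ℝ] (ι → ℝ)) {β : ℝ} (hβ : 0 ≤ β)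
    (h : ∀ f, ∃ C, ∀ k i, |(L ^ k) f i| ≤ C * β ^ k) :
    (spectralRadius ℂ ((LinearMap.toMatrix' L).map (fun x : ℝ => (x : ℂ)))).toReal ≤ β := by
  have : CompleteSpace (Matrix ι ι ℂ) := FiniteDimensional.complete ℂ _
  choose C hC using fun j : ι => h (Pi.single j 1)
  refine spectralRadius_toReal_le_of_norm_pow_le (C := ∑ j, |C j|) _ hβ fun k => ?_
  rw [map_ofReal_pow, Matrix.linfty_opNorm_def, ← NNReal.coe_mk ((∑ j, |C j|) * β ^ k)
    (by positivity), NNReal.coe_le_coe]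
  refine Finset.sup_le fun i _ => ?_
  rw [← NNReal.coe_le_coe, NNReal.coe_sum, NNReal.coe_mk, Finset.sum_mul]
  refine Finset.sum_le_sum fun j _ => ?_
  rw [coe_nnnorm, Matrix.map_apply, Complex.norm_real, Real.norm_eq_abs]
  have h1 := hC j k i
  rw [← toMatrix'_pow_mulVec, Matrix.mulVec_single_one] at h1
  exact h1.trans (mul_le_mul_of_nonneg_right (le_abs_self _) (pow_nonneg hβ k))

/-- A single coordinate of L^k V bounds the norm of the k-th power from below. -/
theorem le_matrix_spectralRadius (L : (ι → ℝ) →ₗ[ℝ] (ι → ℝ)) {α : ℝ} (hα : 0 ≤ α) [Nonempty ι]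
    {V : ι → ℝ} (hV : ∀ i, 0 < V i) (h : ∀ k i, α ^ k * V i ≤ (L ^ k) V i) :
    α ≤ (spectralRadius ℂ ((LinearMap.toMatrix' L).map (fun x : ℝ => (x : ℂ)))).toReal := by
  have : CompleteSpace (Matrix ι ι ℂ) := FiniteDimensional.complete ℂ _
  set VC : ι → ℂ := fun i => (V i : ℂ) with hVC
  obtain ⟨i⟩ := ‹Nonempty ι›
  have hnorm : 0 < ‖VC‖ := by
    rw [norm_pos_iff]
    intro h0
    have := congrFun h0 i
    simp only [hVC, Pi.zero_apply, Complex.ofReal_eq_zero] at this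
    exact (hV i).ne' this
  refine le_spectralRadius_toReal_of_le_norm_pow (c := V i / ‖VC‖) _
    (div_pos (hV i) hnorm) hα fun k => ?_
  rw [map_ofReal_pow, div_mul_eq_mul_div, div_le_iff₀ hnorm]
  refine le_trans ?_ (Matrix.linfty_opNorm_mulVec _ VC)
  refine le_trans ?_ (norm_le_pi_norm _ i)
  have h1 : (((LinearMap.toMatrix' L) ^ k).map (fun x : ℝ => (x : ℂ))).mulVec VC i
      = (((L ^ k) V i : ℝ) : ℂ) := by
    rw [← toMatrix'_pow_mulVec]
    simp [Matrix.mulVec, dotProduct, hVC]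
  rw [h1, Complex.norm_real, Real.norm_eq_abs, mul_comm]
  exact (h k i).trans (le_abs_self _)

end Matrix

/-! ### Sub- and supersolutions in a cone -/

section Cone

variable {ι : Type*} {K : Set (ι → ℝ)} {L : (ι → ℝ) →ₗ[ℝ] (ι → ℝ)} {V : ι → ℝ}

theorem pow_apply_mem (hL : ∀ f ∈ K, L f ∈ K) {f : ι → ℝ} (hf : f ∈ K) (k : ℕ) :
    (L ^ k) f ∈ K := by
  induction k with
  | zero => simpa using hf
  | succ k ih => rw [pow_succ']; exact hL _ ih

/-- If `L V` differs from `β V` by `± W` with `W` in an invariant cone, then so do the powers. -/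
theorem smul_pow_sub_mem (hadd : ∀ f ∈ K, ∀ g ∈ K, f + g ∈ K)
    (hsmul : ∀ c : ℝ, 0 ≤ c → ∀ f ∈ K, c • f ∈ K) (hL : ∀ f ∈ K, L f ∈ K) {β τ : ℝ} (hβ : 0 ≤ β)
    (h : τ • (β • V - L V) ∈ K) (k : ℕ) : τ • (β ^ k • V - (L ^ k) V) ∈ K := by
  induction k with
  | zero => simpa using hsmul 0 le_rfl _ h
  | succ k ih =>
    have h1 : τ • (β ^ (k + 1) • V - (L ^ (k + 1)) V)
        = L (τ • (β ^ k • V - (L ^ k) V)) + β ^ k • (τ • (β • V - L V)) := by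
      have h2 : (L ^ (k + 1)) V = L ((L ^ k) V) := by rw [pow_succ']; rfl
      rw [h2]
      simp only [map_smul, map_sub, pow_succ]
      module
    rw [h1]
    exact hadd _ (hL _ ih) _ (hsmul _ (pow_nonneg hβ k) _ h)

/-- V is an order unit: every f lies between multiples of -V and V in the cone order. As L V ≤ β V
in that order, all orbits grow at most like β^k. -/
theorem abs_pow_apply_le [Fintype ι] (hadd : ∀ f ∈ K, ∀ g ∈ K, f + g ∈ K)
    (hsmul : ∀ c : ℝ, 0 ≤ c → ∀ f ∈ K, c • f ∈ K) (hL : ∀ f ∈ K, L f ∈ K)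
    (hnonneg : ∀ f ∈ K, ∀ i, 0 ≤ f i) (hV : ∀ i, 0 ≤ V i)
    (hint : ∀ f : ι → ℝ, ∃ c : ℝ, 0 ≤ c ∧ c • V + f ∈ K) {β : ℝ} (hβ : 0 ≤ β)
    (h : β • V - L V ∈ K) (f : ι → ℝ) : ∃ C, ∀ k i, |(L ^ k) f i| ≤ C * β ^ k := by
  obtain ⟨c, hc, hcf⟩ := hint f
  obtain ⟨d, hd, hdf⟩ := hint (-f)
  refine ⟨(c + d) * ∑ i, V i, fun k i => ?_⟩
  have h1 := hnonneg _ (pow_apply_mem hL hcf k) i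
  have h2 := hnonneg _ (pow_apply_mem hL hdf k) i
  have h3 := hnonneg _ (smul_pow_sub_mem hadd hsmul hL (τ := 1) hβ (by simpa using h) k) i
  simp only [map_add, map_smul, map_neg, Pi.add_apply, Pi.smul_apply, Pi.neg_apply,
    smul_eq_mul, Pi.sub_apply, one_mul] at h1 h2 h3
  have h4 : V i ≤ ∑ i, V i := Finset.single_le_sum (fun i _ => hV i) (Finset.mem_univ i)
  have h5 := mul_le_mul_of_nonneg_left h4 (pow_nonneg hβ k)
  have h6 : 0 ≤ β ^ k * V i := mul_nonneg (pow_nonneg hβ k) (hV i)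
  have h7 : (L ^ k) V i ≤ β ^ k * ∑ i, V i := by linarith
  have h8 := mul_le_mul_of_nonneg_left h7 hc
  have h9 := mul_le_mul_of_nonneg_left h7 hd
  have h10 : 0 ≤ c * (β ^ k * ∑ i, V i) := mul_nonneg hc (h6.trans h5)
  have h11 : 0 ≤ d * (β ^ k * ∑ i, V i) := mul_nonneg hd (h6.trans h5)
  rw [abs_le]
  constructor <;> nlinarith

end Cone

/-! ### The spectral radius of the transfer operator -/

namespace IFS

variable {a b : ℝ} {n : ℕ}

/-- Nonnegative weights preserve domination by the eigenfunction f, and each application of the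
operator contributes one factor c. -/
theorem norm_transferOp_pow_apply_le (F : IFS a b n) {s : ℝ} (hs : 0 < s) {f : C(Icc a b, ℝ)}
    {c : ℝ} (hf : F.transferOp ℝ s hs f = c • f) {u : C(Icc a b, ℂ)} {B : ℝ}
    (hu : ∀ t, ‖u t‖ ≤ B * f t) (k : ℕ) (t : Icc a b) :
    ‖(F.transferOp ℂ s hs ^ k) u t‖ ≤ B * c ^ k * f t := by
  induction k generalizing t with
  | zero => simpa using hu t
  | succ k ih =>
    rw [pow_succ', mul_apply_eq_comp, transferOp_apply]
    refine (norm_sum_le _ _).trans ?_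
    have h1 := congrArg (fun g : C(Icc a b, ℝ) => g t) hf
    simp only [transferOp_apply, ContinuousMap.coe_smul, Pi.smul_apply, smul_eq_mul] at h1
    have h2 : B * c ^ (k + 1) * f t = ∑ p, (F.g p t ^ s)
        * (B * c ^ k * f ⟨F.θ p t, F.mapsTo p t.2⟩) := by
      rw [pow_succ, show B * (c ^ k * c) * f t = B * c ^ k * (c * f t) by ring, ← h1,
        Finset.mul_sum]
      refine Finset.sum_congr rfl fun p _ => ?_
      simp only [RCLike.ofReal_real_eq_id, id]
      ring
    rw [h2]
    refine Finset.sum_le_sum fun p _ => ?_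
    have hg : 0 ≤ F.g p t ^ s := Real.rpow_nonneg (F.g_nonneg p t t.2) s
    rw [norm_mul, RCLike.norm_ofReal, abs_of_nonneg hg]
    exact mul_le_mul_of_nonneg_left (ih _) hg

/-- A strictly positive eigenfunction belongs to the spectral radius. -/
theorem lam_eq_of_pos_eigen (hab : a < b) (F : IFS a b n) {s : ℝ} (hs : 0 < s)
    {f : C(Icc a b, ℝ)} (hpos : ∀ t, 0 < f t) {c : ℝ} (hc : 0 ≤ c)
    (hf : F.transferOp ℝ s hs f = c • f) : F.lam s hs = c := by
  have : Nonempty (Icc a b) := ⟨⟨a, left_mem_Icc.2 hab.le⟩⟩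
  obtain ⟨t₀, -, ht₀⟩ := isCompact_univ.exists_isMinOn univ_nonempty f.continuous.continuousOn
  have hmin : ∀ t, f t₀ ≤ f t := fun t => ht₀ (mem_univ t)
  unfold lam
  apply le_antisymm
  · refine spectralRadius_toReal_le_of_norm_pow_le (C := ‖f‖ / f t₀) (F.transferOp ℂ s hs) hc fun k => ?_
    refine ContinuousLinearMap.opNorm_le_bound _
      (mul_nonneg (div_nonneg (norm_nonneg _) (hpos _).le) (pow_nonneg hc k)) fun u => ?_
    rw [ContinuousMap.norm_le _ (mul_nonneg (mul_nonneg (div_nonneg (norm_nonneg _) (hpos _).le)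
      (pow_nonneg hc k)) (norm_nonneg _))]
    intro t
    -- The positive minimum of f on the compact interval lets f dominate every u.
    have hu : ∀ t, ‖u t‖ ≤ ‖u‖ / f t₀ * f t := by
      intro t
      rw [div_mul_eq_mul_div, le_div_iff₀ (hpos _)]
      exact mul_le_mul (u.norm_coe_le_norm t) (hmin t) (hpos _).le (norm_nonneg _)
    refine (F.norm_transferOp_pow_apply_le hs hf hu k t).trans ?_
    have h1 : f t ≤ ‖f‖ := (le_abs_self _).trans (f.norm_coe_le_norm t)
    have h2 : 0 ≤ ‖u‖ / f t₀ * c ^ k :=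
      mul_nonneg (div_nonneg (norm_nonneg _) (hpos _).le) (pow_nonneg hc k)
    refine (mul_le_mul_of_nonneg_left h1 h2).trans (le_of_eq ?_)
    ring
  · set fC : C(Icc a b, ℂ) := ⟨fun t => (f t : ℂ), by fun_prop⟩ with hfC
    have heig : F.transferOp ℂ s hs fC = (c : ℂ) • fC := by
      ext t
      have h1 := congrArg (fun g : C(Icc a b, ℝ) => g t) hf
      simp only [transferOp_apply, ContinuousMap.coe_smul, Pi.smul_apply, smul_eq_mul] at h1
      rw [transferOp_apply]
      simp only [ContinuousMap.coe_smul, Pi.smul_apply, smul_eq_mul, hfC, ContinuousMap.coe_mk]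
      rw [← Complex.ofReal_mul, ← h1]
      push_cast
      rfl
    have hpow : ∀ k : ℕ, (F.transferOp ℂ s hs ^ k) fC = (c : ℂ) ^ k • fC := by
      intro k
      induction k with
      | zero => simp
      | succ k ih =>
        rw [pow_succ', mul_apply_eq_comp, ih, map_smul, heig, smul_smul, pow_succ]
    have hn : 0 < ‖fC‖ := by
      rw [norm_pos_iff]
      intro h0
      have := congrArg (fun g : C(Icc a b, ℂ) => g t₀) h0
      simp only [hfC, ContinuousMap.coe_mk, ContinuousMap.zero_apply,
        Complex.ofReal_eq_zero] at this
      exact (hpos t₀).ne' this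
    refine le_spectralRadius_toReal_of_le_norm_pow (c := 1) (F.transferOp ℂ s hs) one_pos hc fun k => ?_
    have h1 := (F.transferOp ℂ s hs ^ k).le_opNorm fC
    rw [hpow, norm_smul, norm_pow, Complex.norm_real, Real.norm_of_nonneg hc] at h1
    rw [one_mul]
    exact le_of_mul_le_mul_right h1 hn

/-! ### Weights and words -/

theorem g_pos (F : IFS a b n) (hg : F.LogLipschitzWeights) (p : Fin n) {t : ℝ}
    (ht : t ∈ Icc a b) : 0 < F.g p t := by
  obtain ⟨h1, M₀, -, h2⟩ := hg
  obtain ⟨t₁, ht₁, hne⟩ := h1 p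
  have h3 : 0 < F.g p t₁ := (F.g_nonneg p t₁ ht₁).lt_of_ne' hne
  exact pos_of_mul_pos_left (h3.trans_le (h2 p t₁ ht₁ t ht)) (Real.exp_pos _).le

theorem wordMap_mem (F : IFS a b n) (w : List (Fin n)) {t : ℝ} (ht : t ∈ Icc a b) :
    F.wordMap w t ∈ Icc a b := by
  induction w with
  | nil => exact ht
  | cons p w ih => exact F.mapsTo p ih

theorem wordWeight_nonneg (F : IFS a b n) (w : List (Fin n)) {t : ℝ} (ht : t ∈ Icc a b) :
    0 ≤ F.wordWeight w t := by
  induction w with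
  | nil => exact zero_le_one
  | cons p w ih => exact mul_nonneg (F.g_nonneg p _ (F.wordMap_mem w ht)) ih

theorem wordWeight_le (F : IFS a b n) {B : ℝ} (hB : ∀ p, ∀ t ∈ Icc a b, F.g p t ≤ B)
    (hB0 : 0 ≤ B) (w : List (Fin n)) {t : ℝ} (ht : t ∈ Icc a b) :
    F.wordWeight w t ≤ B ^ w.length := by
  induction w with
  | nil => exact le_rfl
  | cons p w ih =>
    rw [List.length_cons, pow_succ']
    exact mul_le_mul (hB p _ (F.wordMap_mem w ht)) ih (F.wordWeight_nonneg w ht) hB0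

theorem exists_g_le (F : IFS a b n) : ∃ B : ℝ, 0 ≤ B ∧ ∀ p, ∀ t ∈ Icc a b, F.g p t ≤ B := by
  choose B hB using fun p => isCompact_Icc.exists_bound_of_continuousOn (F.g_cont p)
  refine ⟨∑ p, |B p|, by positivity, fun p t ht => ?_⟩
  refine (le_abs_self _).trans ((hB p t ht).trans ((le_abs_self _).trans ?_))
  exact Finset.single_le_sum (f := fun p => |B p|) (fun _ _ => abs_nonneg _) (Finset.mem_univ p)

/-- Iterating the eigenvalue equation `ν` times. -/
theorem sum_words_eq (F : IFS a b n) {s c : ℝ} {v : ℝ → ℝ}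
    (hv : ∀ t ∈ Icc a b, ∑ p, F.g p t ^ s * v (F.θ p t) = c * v t) (ν : ℕ) {t : ℝ}
    (ht : t ∈ Icc a b) :
    ∑ ω : Fin ν → Fin n, F.wordWeight (List.ofFn ω) t ^ s * v (F.wordMap (List.ofFn ω) t)
      = c ^ ν * v t := by
  induction ν with
  | zero => simp [wordWeight, wordMap]
  | succ ν ih =>
    -- Splits off the first letter, whose map is applied last; the eigenvalue equation is then used
    -- at the image point of the remaining word.
    rw [← (Fin.consEquiv fun _ => Fin n).sum_comp, Fintype.sum_prod_type_right, pow_succ', mul_assoc,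
      ← ih, Finset.mul_sum]
    refine Finset.sum_congr rfl fun ω _ => ?_
    have hm := F.wordMap_mem (List.ofFn ω) ht
    have h1 := hv _ hm
    rw [show c * (F.wordWeight (List.ofFn ω) t ^ s * v (F.wordMap (List.ofFn ω) t))
      = F.wordWeight (List.ofFn ω) t ^ s * (c * v (F.wordMap (List.ofFn ω) t)) by ring, ← h1,
      Finset.mul_sum]
    refine Finset.sum_congr rfl fun p _ => ?_
    simp only [Fin.consEquiv, Equiv.coe_fn_mk, List.ofFn_succ, Fin.cons_zero, Fin.cons_succ,
      wordWeight, wordMap]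
    rw [Real.mul_rpow (F.g_nonneg p _ hm) (F.wordWeight_nonneg _ ht)]
    ring

end IFS

/-- With u = log((1 + q)/(1 - q)) this is u ≤ sinh u, since sinh u = 2q/(1 - q²). It is the source
of the denominators in M₁ and M₂. -/
theorem one_add_le_one_sub_mul_exp {q : ℝ} (h0 : 0 ≤ q) (h1 : q < 1) :
    1 + q ≤ (1 - q) * Real.exp (2 * (q / (1 - q ^ 2))) := by
  have hq : 0 < 1 - q := by linarith
  have hu : 0 < (1 + q) / (1 - q) := by positivity
  have hlog : 0 ≤ Real.log ((1 + q) / (1 - q)) :=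
    Real.log_nonneg (by rw [le_div_iff₀ hq]; linarith)
  have h2 := Real.self_le_sinh_iff.2 hlog
  have h3 : Real.sinh (Real.log ((1 + q) / (1 - q))) = 2 * (q / (1 - q ^ 2)) := by
    have h4 : (1 : ℝ) - q ^ 2 ≠ 0 := by
      have : (1 : ℝ) - q ^ 2 = (1 - q) * (1 + q) := by ring
      rw [this]; positivity
    rw [Real.sinh_log hu]
    field_simp
    ring
  rw [h3] at h2
  have h5 := Real.exp_le_exp.2 h2
  rw [Real.exp_log hu, div_le_iff₀ hq] at h5
  linarith

namespace Mesh

variable {a b : ℝ}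

/-! ### The cones `K(M; T)` -/

theorem cone_add (m : Mesh a b) (r : ℕ) (M : ℝ) :
    ∀ f ∈ m.cone r M, ∀ g ∈ m.cone r M, f + g ∈ m.cone r M := by
  intro f hf g hg ξ η
  have h1 := hf ξ η
  have h2 := hg ξ η
  simp only [Pi.add_apply]
  linarith

theorem cone_smul (m : Mesh a b) (r : ℕ) (M : ℝ) :
    ∀ c : ℝ, 0 ≤ c → ∀ f ∈ m.cone r M, c • f ∈ m.cone r M := by
  intro c hc f hf ξ η
  have h1 := mul_le_mul_of_nonneg_left (hf ξ η) hc
  simp only [Pi.smul_apply, smul_eq_mul]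
  linarith

theorem nodes_nontrivial (m : Mesh a b) {r : ℕ} (hr : 1 ≤ r) (i : Fin m.I) :
    Nontrivial (m.nodes r) := by
  let j : Fin (m.N i) := ⟨0, m.N_pos i⟩
  refine ⟨⟨_, m.node_mem r i j 0⟩, ⟨_, m.node_mem r i j (Fin.last r)⟩, fun h => ?_⟩
  have h1 : (0 : ℕ) = r := congrArg Fin.val (m.node_injective hr i j (Subtype.ext_iff.1 h))
  omega

/-- If f ξ < 0, the cone inequalities for ξ and a second node η give f η < f ξ and then f ξ < f η.
This needs M > 0 and at least two nodes. -/
theorem cone_nonneg (m : Mesh a b) {r : ℕ} (hr : 1 ≤ r) (i : Fin m.I) {M : ℝ} (hM : 0 < M) :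
    ∀ f ∈ m.cone r M, ∀ ξ, 0 ≤ f ξ := by
  intro f hf ξ
  have := m.nodes_nontrivial hr i
  obtain ⟨η, hη⟩ := exists_ne ξ
  have hd : 0 < |(ξ : ℝ) - η| := abs_pos.2 (sub_ne_zero.2 fun h => hη (Subtype.ext h.symm))
  have he : 1 < Real.exp (M * |(ξ : ℝ) - η|) := Real.one_lt_exp_iff.2 (mul_pos hM hd)
  have h1 := hf ξ η
  have h2 := hf η ξ
  rw [abs_sub_comm] at h2
  by_contra! hneg
  have h3 : f η < f ξ := by nlinarith
  nlinarith

theorem cone_mono (m : Mesh a b) {r : ℕ} (hr : 1 ≤ r) (i : Fin m.I) {M M' : ℝ} (hM' : 0 < M')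
    (hM : M' ≤ M) : m.cone r M' ⊆ m.cone r M := by
  intro f hf ξ η
  refine (hf ξ η).trans (mul_le_mul_of_nonneg_right ?_ (m.cone_nonneg hr i hM' f hf η))
  exact Real.exp_le_exp.2 (mul_le_mul_of_nonneg_right hM (abs_nonneg _))

/-- Positive elements of `K(M'; T)` are interior points of `K(M; T)` if `M' < M`. -/
theorem exists_smul_add_mem_cone (m : Mesh a b) {r : ℕ} {M M' : ℝ} (hM : M' < M)
    {V : m.nodes r → ℝ} (hV : V ∈ m.cone r M') (hpos : ∀ ξ, 0 < V ξ) (f : m.nodes r → ℝ) :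
    ∃ c : ℝ, 0 ≤ c ∧ c • V + f ∈ m.cone r M := by
  -- Off the diagonal V satisfies the inequality for M strictly, so a large multiple of V absorbs f;
  -- there are only finitely many pairs.
  have key : ∀ ξ η : m.nodes r, ∀ᶠ c : ℝ in atTop,
      (c • V + f) ξ ≤ Real.exp (M * |(ξ : ℝ) - η|) * (c • V + f) η := by
    intro ξ η
    by_cases h : ξ = η
    · subst h
      simp
    have hd : 0 < |(ξ : ℝ) - η| := abs_pos.2 (sub_ne_zero.2 fun h' => h (Subtype.ext h'))
    have he : Real.exp (M' * |(ξ : ℝ) - η|) < Real.exp (M * |(ξ : ℝ) - η|) :=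
      Real.exp_lt_exp.2 (mul_lt_mul_of_pos_right hM hd)
    have h1 := hV ξ η
    have h2 : 0 < Real.exp (M * |(ξ : ℝ) - η|) * V η - V ξ := by nlinarith [hpos η]
    filter_upwards [eventually_ge_atTop ((f ξ - Real.exp (M * |(ξ : ℝ) - η|) * f η)
      / (Real.exp (M * |(ξ : ℝ) - η|) * V η - V ξ))] with c hc
    rw [div_le_iff₀ h2] at hc
    simp only [Pi.add_apply, Pi.smul_apply, smul_eq_mul]
    linarith
  obtain ⟨c, hc, hc0⟩ := ((eventually_all.2 fun ξ => eventually_all.2 (key ξ)).and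
    (eventually_ge_atTop 0)).exists
  exact ⟨c, hc0, hc⟩

/-- On the separated set of nodes, small relative perturbations of a log-Lipschitz function remain
log-Lipschitz. -/
theorem mem_cone_of_abs_sub_le (m : Mesh a b) {r : ℕ} (hr : 1 ≤ r) (hgap : m.GapCondition r)
    (i : Fin m.I) {V f : m.nodes r → ℝ} (hpos : ∀ ξ, 0 < V ξ) {c q M : ℝ}
    (hV : V ∈ m.cone r c) (hq0 : 0 ≤ q) (hq1 : q < 1) (hf : ∀ ξ, |f ξ - V ξ| ≤ q * V ξ)
    (hM : c + q / (1 - q ^ 2) * (1 / (Real.sin (Real.pi / (2 * r + 2)) ^ 2 * m.hmin)) ≤ M) :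
    f ∈ m.cone r M := by
  intro ξ η
  by_cases h : ξ = η
  · subst h
    simp
  have hd := m.nodes_separated hr hgap ξ.2 η.2 fun h' => h (Subtype.ext h')
  set d := |(ξ : ℝ) - η|
  set τ := Real.sin (Real.pi / (2 * r + 2)) ^ 2 * m.hmin with hτ
  have hτ0 : 0 < τ := mul_pos (pow_pos sin_pos 2) (m.hmin_pos i)
  have hd' : 2 * τ ≤ d := by rw [hτ]; linarith
  have hQ : 0 ≤ q / (1 - q ^ 2) := div_nonneg hq0 (by nlinarith)
  -- Separation d ≥ 2τ converts an additive constant in the exponent into a multiple of the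
  -- distance.
  have h1 : 2 * (q / (1 - q ^ 2)) ≤ q / (1 - q ^ 2) * (1 / τ) * d := by
    rw [mul_one_div, div_mul_eq_mul_div, le_div_iff₀ hτ0]
    nlinarith
  have h2 : 2 * (q / (1 - q ^ 2)) + c * d ≤ M * d := by
    have := mul_le_mul_of_nonneg_right hM (by linarith : 0 ≤ d)
    linarith
  have h3 := Real.exp_le_exp.2 h2
  rw [Real.exp_add] at h3
  have hfξ : f ξ ≤ (1 + q) * V ξ := by linarith [(abs_le.1 (hf ξ)).2]
  have hfη : (1 - q) * V η ≤ f η := by linarith [(abs_le.1 (hf η)).1]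
  have hfη0 : 0 ≤ f η := (mul_nonneg (by linarith) (hpos η).le).trans hfη
  calc f ξ ≤ (1 + q) * V ξ := hfξ
    _ ≤ (1 - q) * Real.exp (2 * (q / (1 - q ^ 2))) * (Real.exp (c * d) * V η) :=
        mul_le_mul (one_add_le_one_sub_mul_exp hq0 hq1) (hV ξ η) (hpos ξ).le
          (mul_nonneg (by linarith) (Real.exp_pos _).le)
    _ = Real.exp (2 * (q / (1 - q ^ 2))) * Real.exp (c * d) * ((1 - q) * V η) := by ring
    _ ≤ Real.exp (M * d) * f η :=
        mul_le_mul h3 hfη (mul_nonneg (by linarith) (hpos η).le) (Real.exp_pos _).le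

/-! ### Spectral radius and entries of the discrete operator -/

theorem discreteOp_apply {n : ℕ} (m : Mesh a b) (F : IFS a b n) (r ν : ℕ) (s : ℝ)
    (f : m.nodes r → ℝ) (ξ : m.nodes r) :
    m.discreteOp F r ν s f ξ = ∑ ω : Fin ν → Fin n,
      F.wordWeight (List.ofFn ω) ξ ^ s * m.interp r (F.wordMap (List.ofFn ω) ξ) f := by
  simp [discreteOp]

/-- The two-sided bound for the spectral radius of a discrete operator that maps the cone `K(M; T)`
into a smaller one and has an approximate eigenvector `V`. -/
theorem discreteRadius_bounds {n : ℕ} (m : Mesh a b) (F : IFS a b n) {r ν : ℕ} {s : ℝ}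
    (hr : 1 ≤ r) (hgap : m.GapCondition r) (i : Fin m.I)
    {V : m.nodes r → ℝ} (hpos : ∀ ξ, 0 < V ξ) {c q δ Λ M M' : ℝ} (hV : V ∈ m.cone r c)
    (hq0 : 0 ≤ q) (hq1 : q < 1) (hqδ : q < δ) (hΛ : 0 < Λ)
    (hAV : ∀ ξ, |m.discreteOp F r ν s V ξ - Λ * V ξ| ≤ q * Λ * V ξ)
    (hM' : 0 < M') (hMM' : M' < M)
    (hM : c + q / δ / (1 - (q / δ) ^ 2)
      * (1 / (Real.sin (Real.pi / (2 * r + 2)) ^ 2 * m.hmin)) ≤ M)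
    (hA : ∀ f ∈ m.cone r M, m.discreteOp F r ν s f ∈ m.cone r M') :
    m.discreteRadius F r ν s ≤ (1 + δ) * Λ ∧
      (δ < 1 → (1 - δ) * Λ ≤ m.discreteRadius F r ν s) := by
  set A := m.discreteOp F r ν s with hAdef
  have hδ : 0 < δ := hq0.trans_lt hqδ
  have hδΛ : 0 < δ * Λ := mul_pos hδ hΛ
  have hqδ0 : 0 ≤ q / δ := div_nonneg hq0 hδ.le
  have hqδ1 : q / δ < 1 := (div_lt_one hδ).2 hqδ
  have hnn := m.cone_nonneg hr i (hM'.trans hMM')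
  have hK : ∀ f ∈ m.cone r M, A f ∈ m.cone r M :=
    fun f hf => m.cone_mono hr i hM' hMM'.le (hA f hf)
  have hadd := m.cone_add r M
  have hsmul := m.cone_smul r M
  -- After division by δ Λ this is a perturbation of V of relative size q/δ. The signs τ = ±1 give
  -- the two comparisons in the cone order.
  have hpert : ∀ τ : ℝ, |τ| = 1 → (δ * Λ) • V + τ • (A V - Λ • V) ∈ m.cone r M := by
    intro τ hτ
    have h1 : V + (τ / (δ * Λ)) • (A V - Λ • V) ∈ m.cone r M := by
      refine m.mem_cone_of_abs_sub_le hr hgap i hpos hV hqδ0 hqδ1 (fun ξ => ?_) hM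
      simp only [Pi.add_apply, Pi.smul_apply, Pi.sub_apply, smul_eq_mul, add_sub_cancel_left]
      rw [abs_mul, abs_div, hτ, abs_of_pos hδΛ, one_div, inv_mul_le_iff₀ hδΛ]
      refine (hAV ξ).trans (le_of_eq ?_)
      field_simp
    have h2 := hsmul _ hδΛ.le _ h1
    rw [smul_add, smul_smul, mul_div_cancel₀ _ hδΛ.ne'] at h2
    exact h2
  have hVM : V ∈ m.cone r M := by
    refine m.mem_cone_of_abs_sub_le hr hgap i hpos hV le_rfl one_pos (fun ξ => by simp) ?_
    have h1 : 0 ≤ q / δ / (1 - (q / δ) ^ 2)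
        * (1 / (Real.sin (Real.pi / (2 * r + 2)) ^ 2 * m.hmin)) := by
      have := m.hmin_pos i
      have h2 : 0 ≤ 1 - (q / δ) ^ 2 := by nlinarith
      positivity
    simp only [zero_div, zero_mul, add_zero]
    linarith
  have hAVpos : ∀ ξ, 0 < A V ξ := by
    intro ξ
    have h1 := (abs_le.1 (hAV ξ)).1
    have h2 : 0 < (1 - q) * (Λ * V ξ) := mul_pos (by linarith) (mul_pos hΛ (hpos ξ))
    linarith
  constructor
  · have hβ : 0 ≤ (1 + δ) * Λ := by positivity
    -- The supersolution is A V rather than V: it lies in K(M'; T) and is positive, hence an order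
    -- unit for K(M; T), whereas V might lie on the boundary.
    have hsup : ((1 + δ) * Λ) • A V - A (A V) ∈ m.cone r M := by
      have h1 := hK _ (hpert (-1) (by simp))
      have h2 : ((1 + δ) * Λ) • A V - A (A V)
          = A ((δ * Λ) • V + (-1 : ℝ) • (A V - Λ • V)) := by
        simp only [map_add, map_smul, map_sub]
        module
      rwa [h2]
    exact matrix_spectralRadius_le A hβ fun f =>
      abs_pow_apply_le hadd hsmul hK hnn (fun ξ => (hAVpos ξ).le)
        (m.exists_smul_add_mem_cone hMM' (hA V hVM) hAVpos) hβ hsup f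
  · intro hδ1
    have hα : 0 ≤ (1 - δ) * Λ := mul_nonneg (by linarith) hΛ.le
    have hsub : (-1 : ℝ) • (((1 - δ) * Λ) • V - A V) ∈ m.cone r M := by
      have h1 := hpert 1 (by simp)
      have h2 : (-1 : ℝ) • (((1 - δ) * Λ) • V - A V)
          = (δ * Λ) • V + (1 : ℝ) • (A V - Λ • V) := by module
      rwa [h2]
    have := (m.nodes_nontrivial hr i).to_nonempty
    refine le_matrix_spectralRadius A hα hpos fun k ξ => ?_
    have h1 := hnn _ (smul_pow_sub_mem hadd hsmul hK hα hsub k) ξ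
    simp only [Pi.smul_apply, Pi.sub_apply, smul_eq_mul] at h1
    linarith

theorem exists_interval {n : ℕ} (m : Mesh a b) {F : IFS a b n} {ν : ℕ} (hn : 1 ≤ n)
    (habs : m.Absorbs F ν) : Nonempty (Fin m.I) :=
  let ⟨i, _⟩ := habs fun _ => ⟨0, hn⟩
  ⟨i⟩

/-- An entry is a value of the operator on a unit vector, so the interpolation bound applies; no gap
condition between intervals enters. -/
theorem abs_discreteMatrix_le {n : ℕ} (m : Mesh a b) {F : IFS a b n} {r ν : ℕ} {s B : ℝ}
    (hr : 1 ≤ r) (hs : 0 < s) (habs : m.Absorbs F ν) (hB0 : 0 ≤ B)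
    (hB : ∀ p, ∀ t ∈ Icc a b, F.g p t ≤ B) (ξ η : m.nodes r) :
    |m.discreteMatrix F r ν s ξ η| ≤ ∑ _ω : Fin ν → Fin n, (B ^ ν) ^ s
      * ((r + 1) * (1 / (2 * Real.sin (Real.pi / (2 * r + 2)) ^ 2)) ^ r) := by
  have hξ := m.nodes_subset hr ξ.2
  rw [discreteMatrix, LinearMap.toMatrix'_apply, discreteOp_apply]
  refine (Finset.abs_sum_le_sum_abs _ _).trans (Finset.sum_le_sum fun ω _ => ?_)
  have hw0 := F.wordWeight_nonneg (List.ofFn ω) hξ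
  obtain ⟨i, hi⟩ := habs ω
  rw [abs_mul, abs_of_nonneg (Real.rpow_nonneg hw0 s)]
  refine mul_le_mul (Real.rpow_le_rpow hw0 ?_ hs.le) (m.abs_interp_le hr i (hi hξ) fun ζ => ?_)
    (abs_nonneg _) (by positivity)
  · simpa using F.wordWeight_le hB hB0 (List.ofFn ω) hξ
  · simp only [Pi.single_apply]
    split_ifs <;> simp

end Mesh

end TransferIFS

/-! ### Assembly of the bounds and the matrix comparison -/

theorem theorem6p6 {a b : ℝ} (hab : a < b) {n : ℕ} (hn : 1 ≤ n) (F : IFS a b n)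
    (s : ℝ) (hs : 0 < s) (r ν : ℕ) (hr : 1 ≤ r) (hν : 1 ≤ ν)
    (hg : F.LogLipschitzWeights) (hθ : F.UniformlyContracting) (hF : F.Smooth (r + 1)) :
    -- the two bounds for the spectral radius of the transfer operator
    (∀ v : ℝ → ℝ, F.IsPositiveEigenfunction s hs (r + 1) v →
      ∀ E χ : ℝ, 0 < χ →
      (∀ x ∈ Icc a b, |iteratedDerivWithin (r + 1) v (Icc a b) x| / v x ≤ E) →
      (∀ x₁ ∈ Icc a b, ∀ x₂ ∈ Icc a b, v x₁ ≤ v x₂ * Real.exp (2 * s * |x₁ - x₂| / χ)) →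
      ∀ m : Mesh a b, m.Absorbs F ν → m.GapCondition r → m.h < 1 →
      m.G r s E χ * m.h ^ (r + 1) < 1 →
      ∀ H : ℝ, m.G r s E χ < H →
      ∀ M M' : ℝ, 0 < M' → M' < M → m.M₂ r s E χ H ≤ M →
      (∀ f ∈ m.cone r M, m.discreteOp F r ν s f ∈ m.cone r M') →
        ((1 + H * m.h ^ r)⁻¹ * m.discreteRadius F r ν s) ^ (1 / (ν : ℝ)) ≤ F.lam s hs ∧
        (H * m.h ^ r < 1 →
          F.lam s hs ≤ ((1 - H * m.h ^ r)⁻¹ * m.discreteRadius F r ν s) ^ (1 / (ν : ℝ)))) ∧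
    -- the entries of the two rescaled matrices differ by `O(h ^ r)`
    (∀ Hmax : ℝ, 0 < Hmax → ∃ C > 0, ∃ h₀ > 0, ∀ m : Mesh a b, m.Absorbs F ν → m.h ≤ h₀ →
      ∀ H : ℝ, 0 < H → H ≤ Hmax →
        H * m.h ^ r < 1 ∧ ∀ ξ η : m.nodes r,
          |((1 + H * m.h ^ r)⁻¹ • m.discreteMatrix F r ν s) ξ η
            - ((1 - H * m.h ^ r)⁻¹ • m.discreteMatrix F r ν s) ξ η| ≤ C * m.h ^ r) := by

  constructor
  · intro v hv E χ hχ hE hlip m habs hgap hh1 hGh H hGH M M' hM' hMM' hM hA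
    obtain ⟨i⟩ := m.exists_interval hn habs
    obtain ⟨f, hfv, c, hfc⟩ := hv.eigen
    have hh := m.h_pos i
    have hmin := m.hmin_pos i
    have heig : ∀ t ∈ Icc a b, ∑ p, F.g p t ^ s * v (F.θ p t) = c * v t := by
      intro t ht
      have h1 := congrArg (fun g : C(Icc a b, ℝ) => g ⟨t, ht⟩) hfc
      simpa only [IFS.transferOp_apply, ContinuousMap.coe_smul, Pi.smul_apply, smul_eq_mul, hfv,
        RCLike.ofReal_real_eq_id, id] using h1
    have ha : a ∈ Icc a b := left_mem_Icc.2 hab.le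
    have hc : 0 < c := by
      have : Nonempty (Fin n) := ⟨⟨0, hn⟩⟩
      refine pos_of_mul_pos_left (b := v a) ?_ (hv.pos a ha).le
      rw [← heig a ha]
      exact Finset.sum_pos (fun p _ => mul_pos (Real.rpow_pos_of_pos (F.g_pos hg p ha) s)
        (hv.pos _ (F.mapsTo p ha))) Finset.univ_nonempty
    have hlam : F.lam s hs = c :=
      F.lam_eq_of_pos_eigen hab hs (fun t => by rw [hfv]; exact hv.pos t t.2) hc.le hfc
    have hE0 : 0 ≤ E := (div_nonneg (abs_nonneg _) (hv.pos a ha).le).trans (hE a ha)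
    have hcos := Mesh.cos_pos hr
    have hG0 : 0 ≤ m.G r s E χ := by
      unfold Mesh.G
      positivity
    have hH : 0 < H := hG0.trans_lt hGH
    have hq0 : 0 ≤ m.G r s E χ * m.h ^ (r + 1) := by positivity
    have hδ : 0 < H * m.h ^ r := by positivity
    have hqδ : m.G r s E χ * m.h ^ (r + 1) / (H * m.h ^ r) = m.G r s E χ / H * m.h := by
      field_simp
      ring
    -- G < H compares the constants, and h < 1 disposes of the extra power of h.
    have hlt : m.G r s E χ * m.h ^ (r + 1) < H * m.h ^ r := by
      rw [pow_succ, ← mul_assoc]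
      have h1 : m.G r s E χ * m.h ^ r < H * m.h ^ r :=
        mul_lt_mul_of_pos_right hGH (by positivity)
      have h2 : 0 ≤ m.G r s E χ * m.h ^ r := by positivity
      nlinarith
    have hAV : ∀ ξ : m.nodes r, |m.discreteOp F r ν s (fun ξ => v ξ) ξ - c ^ ν * v ξ|
        ≤ m.G r s E χ * m.h ^ (r + 1) * c ^ ν * v ξ := by
      intro ξ
      have hξ := m.nodes_subset hr ξ.2
      rw [m.discreteOp_apply, mul_assoc, ← F.sum_words_eq heig ν hξ, ← Finset.sum_sub_distrib,
        Finset.mul_sum]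
      refine (Finset.abs_sum_le_sum_abs _ _).trans (Finset.sum_le_sum fun ω _ => ?_)
      have hw := Real.rpow_nonneg (F.wordWeight_nonneg (List.ofFn ω) hξ) s
      obtain ⟨i', hi'⟩ := habs ω
      rw [← mul_sub, abs_mul, abs_of_nonneg hw]
      refine (mul_le_mul_of_nonneg_left (m.abs_interp_sub_le hab hr
        (by exact_mod_cast hv.contDiffOn) hv.pos hs hχ hE hlip i' (hi' hξ)) hw).trans
        (le_of_eq (by ring))
    have hVc : (fun ξ : m.nodes r => v ξ) ∈ m.cone r (2 * s / χ) := by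
      intro ξ η
      have h1 := hlip ξ (m.nodes_subset hr ξ.2) η (m.nodes_subset hr η.2)
      rwa [mul_comm (v η), mul_div_right_comm] at h1
    have hMc : 2 * s / χ + m.G r s E χ * m.h ^ (r + 1) / (H * m.h ^ r)
        / (1 - (m.G r s E χ * m.h ^ (r + 1) / (H * m.h ^ r)) ^ 2)
        * (1 / (Real.sin (Real.pi / (2 * r + 2)) ^ 2 * m.hmin)) ≤ M := by
      refine le_trans ?_ hM
      rw [hqδ]
      -- Of M₁ only the log-Lipschitz constant of v is kept. The remaining summand of M₂ is the cost
      -- of the perturbation, with h/h_min = μ.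
      have h1 : 2 * s / χ ≤ m.M₁ r s E χ := by
        have h2 : 0 ≤ 1 - m.G r s E χ ^ 2 * m.h ^ (2 * r + 2) := by
          have h3 : m.G r s E χ ^ 2 * m.h ^ (2 * r + 2) = (m.G r s E χ * m.h ^ (r + 1)) ^ 2 := by
            ring
          rw [h3]
          nlinarith
        have h4 : 0 ≤ m.μ := div_nonneg hh.le hmin.le
        unfold Mesh.M₁
        rw [le_add_iff_nonneg_left]
        positivity
      unfold Mesh.M₂
      refine add_le_add h1 (le_of_eq ?_)
      unfold Mesh.μ
      simp only [div_eq_mul_inv, mul_inv]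
      ring
    obtain ⟨hup, hlow⟩ := m.discreteRadius_bounds F hr hgap i
      (fun ξ => hv.pos _ (m.nodes_subset hr ξ.2)) hVc hq0 hGh hlt (pow_pos hc ν) hAV hM' hMM' hMc hA
    have hν0 : ν ≠ 0 := by omega
    have hroot : (c ^ ν) ^ (1 / (ν : ℝ)) = c := by
      rw [one_div, Real.pow_rpow_inv_natCast hc.le hν0]
    have hexp : 0 ≤ 1 / (ν : ℝ) := by positivity
    rw [hlam]
    refine ⟨?_, fun hδ1 => ?_⟩
    · conv_rhs => rw [← hroot]
      have hR : 0 ≤ m.discreteRadius F r ν s := ENNReal.toReal_nonneg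
      refine Real.rpow_le_rpow (by positivity) ?_ hexp
      rwa [inv_mul_le_iff₀ (by positivity)]
    · conv_lhs => rw [← hroot]
      refine Real.rpow_le_rpow (by positivity) ?_ hexp
      rw [le_inv_mul_iff₀ (by linarith)]
      exact hlow hδ1
  · intro Hmax hHmax
    obtain ⟨B, hB0, hB⟩ := F.exists_g_le
    set D : ℝ := ∑ _ω : Fin ν → Fin n, (B ^ ν) ^ s
      * ((r + 1) * (1 / (2 * Real.sin (Real.pi / (2 * r + 2)) ^ 2)) ^ r) with hD
    have hD0 : 0 ≤ D := by positivity
    -- The summand 1 keeps C positive, only D ≥ 0 being known. The bound h ≤ 1 gives h^r ≤ h, and h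
    -- ≤ 1/(2 Hmax) then gives δ ≤ 1/2.
    refine ⟨4 * Hmax * D + 1, by positivity, min 1 (1 / (2 * Hmax)), by positivity, ?_⟩
    intro m habs hmh H hH hHle
    obtain ⟨i⟩ := m.exists_interval hn habs
    have hh := m.h_pos i
    have hhr : m.h ^ r ≤ m.h := pow_le_of_le_one hh.le (hmh.trans (min_le_left _ _)) (by omega)
    have hhr0 : 0 < m.h ^ r := by positivity
    have hδle : H * m.h ^ r ≤ Hmax * m.h ^ r := mul_le_mul_of_nonneg_right hHle hhr0.le
    have hδ : H * m.h ^ r ≤ 1 / 2 := by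
      have h1 : m.h ≤ 1 / (2 * Hmax) := hmh.trans (min_le_right _ _)
      rw [le_div_iff₀ (by positivity)] at h1
      nlinarith
    have hδ0 : 0 < H * m.h ^ r := by positivity
    refine ⟨by linarith, fun ξ η => ?_⟩
    have hent := m.abs_discreteMatrix_le hr hs habs hB0 hB ξ η
    simp only [Matrix.smul_apply, smul_eq_mul]
    rw [← sub_mul, abs_mul]
    set δ := H * m.h ^ r
    -- The difference is 2δ/(1 - δ²) in absolute value, and δ ≤ 1/2 keeps the denominator above 1/2.
    have hfac : |(1 + δ)⁻¹ - (1 - δ)⁻¹| ≤ 4 * δ := by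
      have h1 : (1 + δ)⁻¹ - (1 - δ)⁻¹ = -(2 * δ / ((1 + δ) * (1 - δ))) := by
        have h2 : 1 - δ ≠ 0 := by linarith
        field_simp
        ring
      have h3 : 0 < (1 + δ) * (1 - δ) := mul_pos (by linarith) (by linarith)
      rw [h1, abs_neg, abs_of_pos (by positivity), div_le_iff₀ h3]
      have h4 : 1 / 2 ≤ (1 + δ) * (1 - δ) := by nlinarith
      nlinarith
    calc _ ≤ 4 * δ * D := mul_le_mul hfac hent (abs_nonneg _) (by positivity)
      _ ≤ 4 * (Hmax * m.h ^ r) * D := by gcongr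
      _ ≤ (4 * Hmax * D + 1) * m.h ^ r := by nlinarith
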